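/- For a finite group $H$ let $\mathrm{Irr}(H)$ be its set of irreducible complex characters. A supercharacter theory of $H$ is a pair $(\mathcal X,\mathcal K)$, where $\mathcal X$ is a partition of $\mathrm{Irr}(H)$ and $\mathcal K$ is a partition of $H$ (whose parts are called superclasses), such that $|\mathcal X|=|\mathcal K|$, $\{1\}\in\mathcal K$, and for every $X\in\mathcal X$ the character $\sigma_X=\sum_{\psi\in X}\psi(1)\psi$ is constant on every $K\in\mathcal K$. Write $\mathrm{Sup}(H)$ for the set of supercharacter theories of $H$. If a group $G$ acts on $H$ by automorphisms, write $\mathrm{Sup}_G(H)$ for the set of those that are $G$-invariant, i.e. for which every $K\in\mathcal K$ is fixed setwise by $G$. Normal subgroups of $G$ and quotients $M/N$ with $N\le M$ both normal in $G$ carry the conjugation action of $G$. For $N\trianglelefteq H$, $\mathcal C=(\mathcal X,\mathcal K)\in\mathrm{Sup}_H(N)$ and $\mathcal D=(\mathcal Y,\mathcal L)\in\mathrm{Sup}(H/N)$, the $*$-product over $N$ is $$\mathcal C*\mathcal D=\Bigl(\mathcal Y\cup\{X^H: X\in\mathcal X,\ X\ne\{1_N\}\},\ \ \mathcal K\cup\{\widetilde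 L: L\in\mathcal L,\ L\neq\{N\}\}\Bigr),$$ where $\mathrm{Irr}(H/N)$ is identified with a subset of $\mathrm{Irr}(H)$ by inflation, $X^H$ is the set of $\chi\in\mathrm{Irr}(H)$ such that the restriction $\chi_N$ has a constituent in $X$, and $\widetilde L\subseteq H$ is the preimage of $L\subseteq H/N$. It is a supercharacter theory of $H$. A supercharacter theory of $H$ is indecomposable if $|H|>1$ and it is not of the form $\mathcal C*\mathcal D$ over any normal subgroup $N$ of $H$ with $1\ne N\neq H$. Theorem. Let $G$ be a nontrivial finite group and let $\mathcal C\in\mathrm{Sup}(G)$. Then there exist a chain $1=N_0<N_1<\cdots<N_r=G$ of normal subgroups of $G$ and indecomposable supercharacter theories $\mathcal D_i\in\mathrm{Sup}_G(N_i/N_{i-1})$, $i=1,\dots,r$, such that $$\mathcal C=\mathcal D_1*\mathcal D_2*\cdots*\mathcal D_r,$$ where the iterated product is bracketed from the left, the product of the first $i$ factors being a supercharacter theory of $N_i$ formed over $N_{i-1}$. Moreover the chain together with the $\mathcal D_i$ is uniquely determined by $\mathcal C$: any two such data have the same $r$, the same $N_i$ and the same $\mathcal D_i$. -/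

import Mathlib

noncomputable section

/-- `χ : G → ℂ` is the character of an irreducible finite-dimensional complex representation. -/
def IsIrreducibleCharacter {G : Type*} [Group G] (χ : G → ℂ) : Prop :=
  ∃ (n : ℕ) (ρ : Representation ℂ G (Fin n → ℂ)), ρ.IsIrreducible ∧ ρ.character = χ

/-- `Irr(G)`, the set of irreducible complex characters of `G`. -/
def Irr (G : Type*) [Group G] : Type _ :=
  {χ : G → ℂ // IsIrreducibleCharacter χ}

instance (G : Type*) [Group G] : CoeFun (Irr G) (fun _ => G → ℂ) where
  coe χ := χ.1

/-- The usual inner product `[χ, ψ] = |G|⁻¹ ∑ g, χ(g) ψ(g⁻¹)` of characters of a finite group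
(for characters `ψ(g⁻¹)` is the complex conjugate of `ψ(g)`). -/
def characterInner {G : Type*} [Group G] (χ ψ : G → ℂ) : ℂ :=
  (Nat.card G : ℂ)⁻¹ * ∑ᶠ g : G, χ g * ψ g⁻¹

/-- Distinct irreducible characters of a finite group are orthogonal, and each has norm one. -/
theorem characterInner_irr {G : Type*} [Group G] [Finite G] (χ ψ : Irr G) :
    (χ = ψ → characterInner χ ψ = 1) ∧ (χ ≠ ψ → characterInner χ ψ = 0) := by
  classical
  have : Fintype G := Fintype.ofFinite G
  have : Invertible (Nat.card G : ℂ) :=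
    invertibleOfNonzero (by exact_mod_cast Nat.card_pos.ne')
  obtain ⟨χ, n, ρ, hρ, rfl⟩ := χ
  obtain ⟨ψ, m, τ, hτ, rfl⟩ := ψ
  have h := Representation.char_orthonormal ρ τ
  simp only [characterInner, finsum_eq_sum_of_fintype]
  constructor
  · intro e
    have e' : ρ.character = τ.character := congrArg Subtype.val e
    rw [← e']
    have h' := Representation.char_orthonormal ρ ρ
    rw [h', if_pos ⟨Representation.Equiv.refl ρ⟩]
  · intro e
    rw [h, if_neg]
    rintro ⟨f⟩
    exact e (Subtype.ext (Representation.char_iso f).symm)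

/-- A finite group has finitely many irreducible characters. -/
instance finite_irr (G : Type*) [Group G] [Finite G] : Finite (Irr G) := by
  classical
  have : Fintype G := Fintype.ofFinite G
  have hli : LinearIndependent ℂ (fun χ : Irr G => (χ.1 : G → ℂ)) := by
    rw [linearIndependent_iff']
    intro s c hc ψ hψ
    have h1 : characterInner (∑ χ ∈ s, c χ • (χ.1 : G → ℂ)) ψ.1 = c ψ := by
      have : characterInner (∑ χ ∈ s, c χ • (χ.1 : G → ℂ)) ψ.1
          = ∑ χ ∈ s, c χ * characterInner χ.1 ψ.1 := by
        simp only [characterInner, finsum_eq_sum_of_fintype, Finset.sum_apply, Pi.smul_apply,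
          smul_eq_mul, Finset.mul_sum, Finset.sum_mul]
        rw [Finset.sum_comm]
        refine Finset.sum_congr rfl fun χ _ => Finset.sum_congr rfl fun g _ => by ring
      rw [this, Finset.sum_eq_single ψ]
      · rw [(characterInner_irr ψ ψ).1 rfl, mul_one]
      · intro χ _ hne
        rw [(characterInner_irr χ ψ).2 hne, mul_zero]
      · exact fun h => absurd hψ h
    rw [← h1, hc]
    simp [characterInner]
  exact hli.finite

/-- `σ_X = ∑_{ψ ∈ X} ψ(1) ψ` for a set `X` of irreducible characters. -/
def sigmaChar {G : Type*} [Group G] (X : Set (Irr G)) (g : G) : ℂ :=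
  ∑ᶠ ψ ∈ X, ψ 1 * ψ g

/-- A pair `(𝒳, 𝒦)` of a set of sets of irreducible characters of `G`
and a set of subsets of `G`. -/
@[ext]
structure PartPair (G : Type*) [Group G] where
  chars : Set (Set (Irr G))
  classes : Set (Set G)

/-- A supercharacter theory of the finite group `G`: partitions `chars` of `Irr(G)` and `classes`
of `G` with the same number of parts, `{1}` being one of the classes, such that for every part `X`
of `chars` the character `σ_X` is constant on every part of `classes`. -/
@[ext]
structure SupercharacterTheory (G : Type*) [Group G] extends PartPair G where
  chars_isPartition : Setoid.IsPartition chars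
  classes_isPartition : Setoid.IsPartition classes
  one_mem : {1} ∈ classes
  ncard_eq : chars.ncard = classes.ncard
  sigma_const : ∀ X ∈ chars, ∀ K ∈ classes, ∀ g ∈ K, ∀ h ∈ K, sigmaChar X g = sigmaChar X h

/-- Invariance of a supercharacter theory of `H` under an action of `A` on `H` by automorphisms:
every superclass is fixed setwise. -/
def SupercharacterTheory.IsInvariant {A H : Type*} [Group A] [Group H]
    (C : SupercharacterTheory H) (φ : A →* MulAut H) : Prop :=
  ∀ a : A, ∀ K ∈ C.classes, φ a '' K = K

/-- The action of `G` on `M / N` by conjugation, `g • mN = (g m g⁻¹) N`, for `N` and `M` normal in `G`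
(meant for `N ≤ M`). -/
def conjQuotient {G : Type*} [Group G] (N M : Subgroup G) [N.Normal] [M.Normal] :
    G →* MulAut (M ⧸ N.subgroupOf M) where
  toFun g := QuotientGroup.congr (N.subgroupOf M) (N.subgroupOf M) (MulAut.conjNormal g) (by
    ext x
    constructor
    · rintro ⟨y, hy, rfl⟩
      exact ‹N.Normal›.conj_mem _ hy g
    · intro hx
      refine ⟨MulAut.conjNormal g⁻¹ x, ?_, by ext; simp⟩
      exact ‹N.Normal›.conj_mem _ hx g⁻¹)
  map_one' := by
    ext x
    induction x using QuotientGroup.induction_on with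
    | H x => simp
  map_mul' g h := by
    ext x
    induction x using QuotientGroup.induction_on with
    | H x => simp

/-- The set of irreducible characters of `G` obtained by inflating the members of `Y` along a
surjective homomorphism `π : G → Q`. -/
def inflateChars {G Q : Type*} [Group G] [Group Q] (π : G →* Q) (Y : Set (Irr Q)) :
    Set (Irr G) :=
  {χ | ∃ ψ ∈ Y, ∀ g, χ g = ψ (π g)}

/-- `Z^G = ⋃_{ψ ∈ Z} Irr(G|ψ)`, for a set `Z` of irreducible characters of a subgroup `A` of `G`
(included by `ι`): the irreducible characters of `G` whose restriction to `A` has a constituent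
in `Z`. The inner product below is always a nonnegative integer. -/
def charsAbove {A G : Type*} [Group A] [Group G] (ι : A →* G) (Z : Set (Irr A)) : Set (Irr G) :=
  {χ | ∃ ψ ∈ Z, characterInner (fun a => χ (ι a)) ψ ≠ 0}

/-- The set `{1_A}` whose only element is the trivial character of `A`. -/
def trivialChars (A : Type*) [Group A] : Set (Irr A) :=
  {χ | ∀ a, χ a = 1}

/-- The `*`-product `(𝒴 ∪ (𝒳°)^G, 𝒦 ∪ (ℒ°)~)` of `(𝒳, 𝒦)` on `A` and `(𝒴, ℒ)` on `Q`, where `A` is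
(by `ι`) a normal subgroup of `G` and `Q` is (by `π`) the quotient of `G` by it; `°` removes
`{1_A}` from `𝒳` and `{1}` from `ℒ`. -/
def PartPair.star {A G Q : Type*} [Group A] [Group G] [Group Q] (ι : A →* G) (π : G →* Q)
    (C : PartPair A) (D : PartPair Q) : PartPair G where
  chars := (inflateChars π '' D.chars) ∪ (charsAbove ι '' (C.chars \ {trivialChars A}))
  classes := ((fun K : Set A => ι '' K) '' C.classes) ∪
    ((fun L : Set Q => π ⁻¹' L) '' (D.classes \ {{1}}))

/-- `B` is a `*`-product over the normal subgroup `N`. -/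
def SupercharacterTheory.FactorsOver {G : Type*} [Group G] (B : SupercharacterTheory G)
    (N : Subgroup G) [N.Normal] : Prop :=
  ∃ (C : SupercharacterTheory N) (D : SupercharacterTheory (G ⧸ N)),
    C.IsInvariant (MulAut.conjNormal : G →* MulAut N) ∧
    B.toPartPair = PartPair.star N.subtype (QuotientGroup.mk' N) C.toPartPair D.toPartPair

/-- `C` is a `*`-product over some proper nontrivial normal subgroup. -/
def SupercharacterTheory.Decomposable {G : Type*} [Group G] (C : SupercharacterTheory G) : Prop :=
  ∃ (N : Subgroup G) (_ : N.Normal), N ≠ ⊥ ∧ N ≠ ⊤ ∧ C.FactorsOver N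

/-- `C` is not decomposable and the underlying group is nontrivial. -/
def SupercharacterTheory.Indecomposable {G : Type*} [Group G] (C : SupercharacterTheory G) :
    Prop :=
  Nontrivial G ∧ ¬ C.Decomposable

/-- A chain `1 = N₀ < N₁ < ⋯ < N_r = G` of normal subgroups of `G`. -/
structure NormalChain (G : Type*) [Group G] where
  length : ℕ
  N : Fin (length + 1) → Subgroup G
  normal : ∀ i, (N i).Normal
  zero_eq : N 0 = ⊥
  last_eq : N (Fin.last length) = ⊤
  lt_succ : ∀ i : Fin length, N i.castSucc < N i.succ

namespace NormalChain

instance {G : Type*} [Group G] (c : NormalChain G) (i : Fin (c.length + 1)) : (c.N i).Normal :=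
  c.normal i

/-- The `i`-th factor group `N_{i+1} / N_i` of the chain, `i = 0, …, r - 1`. -/
abbrev Factor {G : Type*} [Group G] (c : NormalChain G) (i : Fin c.length) : Type _ :=
  c.N i.succ ⧸ (c.N i.castSucc).subgroupOf (c.N i.succ)

/-- The partial products `(⋯(D₁ * D₂) * ⋯) * D_k` on `N_k`, for theories `D` of the factors. The
empty product is the only supercharacter theory of the trivial group `N₀`, with one part each. -/
def partialProduct {G : Type*} [Group G] (c : NormalChain G)
    (D : ∀ i : Fin c.length, SupercharacterTheory (c.Factor i)) (k : Fin (c.length + 1)) :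
    PartPair (c.N k) :=
  Fin.induction (motive := fun k => PartPair (c.N k))
    ⟨{Set.univ}, {Set.univ}⟩
    (fun i P => PartPair.star (Subgroup.inclusion (c.lt_succ i).le)
      (QuotientGroup.mk' ((c.N i.castSucc).subgroupOf (c.N i.succ))) P (D i).toPartPair)
    k

end NormalChain

/-- Transport of a pair along an isomorphism. -/
def PartPair.transport {H G : Type*} [Group H] [Group G] (e : H ≃* G) (P : PartPair H) :
    PartPair G where
  chars := inflateChars e.symm.toMonoidHom '' P.chars
  classes := (fun K : Set H => e '' K) '' P.classes

/-- The full product `D₁ * D₂ * ⋯ * D_r` on `G = N_r`. -/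
def NormalChain.product {G : Type*} [Group G] (c : NormalChain G)
    (D : ∀ i : Fin c.length, SupercharacterTheory (c.Factor i)) : PartPair G :=
  PartPair.transport ((MulEquiv.subgroupCongr c.last_eq).trans Subgroup.topEquiv)
    (c.partialProduct D (Fin.last c.length))

end

/-!
Everything is reduced to superclasses. For a supercharacter theory `C` of `G` let `V` be the space
of complex functions on `G` that are constant on superclasses. The characters `σ_X` lie in `V` and
there are `dim V` of them, so they span it (`SupercharacterTheory.constOn_classes`). Under the
central characters `V` becomes the algebra of functions on `Irr(G)` that are constant on the parts
of the partition of `Irr(G)`; in particular `V` consists of class functions and is closed under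
convolution. Conversely, a partition of `G` containing `{1}` with these two properties is the set of
superclasses of a supercharacter theory (`SupercharacterTheory.exists_of_convolution_mem`), because
an algebra of functions on a finite set consists of all functions that are constant on the
sets of points it does not separate. The superclasses also determine the sets of characters
(`SupercharacterTheory.eq_of_classes_eq`).

It follows that `C` is a `*`-product over `N` exactly when every superclass is contained in `N` or
is a union of cosets of `N` (the predicate `FactorsClasses`). The two factors are obtained from the
criterion above, applied to the functions in `V` supported on `N` and to those constant on the
cosets of `N`; that the sets of characters agree too is a count, carried out in
`SupercharacterTheory.toPartPair_eq_star`.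

The subgroups over which `C` factors are linearly ordered by inclusion
(`SupercharacterTheory.le_or_le_of_factorsClasses`): if `x ∈ M \ N`, then the superclass of `x` is
contained in `M` and contains `xN`, whence `N ≤ M`. The required chain consists of all of them. Its
factors are the theories induced on the sections. A decomposition of one of these would give a
further normal subgroup over which `C` factors, strictly between two consecutive terms
(`SupercharacterTheory.exists_lt_lt_of_decomposable`).

For uniqueness, the superclasses of a product over a chain can be written down
(`NormalChain.mem_product_classes`). They factor over every term of the chain, and a further normal
subgroup over which they factor would decompose one of the factors (`NormalChain.range_eq`). So the
chain is the one described, and the superclasses of the product determine those of the factors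
(`NormalChain.factors_eq`).
-/

noncomputable section

/-! ### Central characters of finite groups -/

section

open Representation

/-- Functions constant on the conjugacy classes of a group. -/
def IsClassFunction {G : Type*} [Group G] (f : G → ℂ) : Prop :=
  ∀ g x, f (x * g * x⁻¹) = f g

/-- Convolution of complex functions on a finite group: the product of the group algebra. -/
def convolution {G : Type*} [Group G] (f h : G → ℂ) (x : G) : ℂ :=
  ∑ᶠ y : G, f y * h (y⁻¹ * x)

namespace Irr

/-- The central character of `χ`, evaluated on the group algebra element `∑ g, f(g) g⁻¹`.
Inverting the group elements makes `ω_χ(σ_X)` vanish for `χ ∉ X`, and it does no harm on class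
functions, where convolution is commutative. -/
def centralChar {G : Type*} [Group G] [Finite G] (χ : Irr G) : (G → ℂ) →ₗ[ℂ] ℂ where
  toFun f := (χ 1)⁻¹ * ∑ᶠ g, f g * χ g⁻¹
  map_add' f h := by
    have := Fintype.ofFinite G
    simp only [finsum_eq_sum_of_fintype, Pi.add_apply, add_mul, Finset.sum_add_distrib, mul_add]
  map_smul' c f := by
    have := Fintype.ofFinite G
    simp only [finsum_eq_sum_of_fintype, Pi.smul_apply, smul_eq_mul, Finset.mul_sum,
      RingHom.id_apply]
    exact Finset.sum_congr rfl fun g _ => by ring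

theorem centralChar_apply {G : Type*} [Group G] [Fintype G] (χ : Irr G) (f : G → ℂ) :
    χ.centralChar f = (χ 1)⁻¹ * ∑ g, f g * χ g⁻¹ := by
  simp only [centralChar, finsum_eq_sum_of_fintype]
  rfl

theorem isClassFunction {G : Type*} [Group G] (χ : Irr G) : IsClassFunction χ.1 := by
  obtain ⟨_, n, ρ, hρ, rfl⟩ := χ
  intro g x
  exact ρ.char_conj g x

theorem ext' {G : Type*} [Group G] {χ ψ : Irr G} (h : ∀ g, χ g = ψ g) : χ = ψ :=
  Subtype.ext (funext h)

end Irr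

/-- Transport of irreducibility along an equivalence of representations. -/
theorem Representation.Equiv.isIrreducible {G V W : Type*} [Group G] [AddCommGroup V] [Module ℂ V]
    [AddCommGroup W] [Module ℂ W] {ρ : Representation ℂ G V} {τ : Representation ℂ G W}
    (e : ρ.Equiv τ) (h : ρ.IsIrreducible) : τ.IsIrreducible := by
  have h1 := (irreducible_iff_isSimpleModule_asModule ρ).1 h
  rw [irreducible_iff_isSimpleModule_asModule]
  let f := IntertwiningMap.equivLinearMapAsModule ρ τ e.toIntertwiningMap
  have hf : Function.Bijective f := e.toLinearEquiv.bijective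
  exact IsSimpleModule.congr (LinearEquiv.ofBijective f hf).symm

section Schur

variable {G V : Type*} [Group G] [Fintype G] [AddCommGroup V] [Module ℂ V] [FiniteDimensional ℂ V]

/-- Schur's lemma: a class function acts on an irreducible representation as a scalar. -/
theorem Representation.sum_classFunction_smul_eq (ρ : Representation ℂ G V) (hρ : ρ.IsIrreducible)
    {f : G → ℂ} (hf : IsClassFunction f) :
    ∃ c : ℂ, ∑ g, f g • ρ g⁻¹ = c • LinearMap.id ∧
      c * Module.finrank ℂ V = ∑ g, f g * ρ.character g⁻¹ := by
  have hcomm : ∀ x v, (∑ g, f g • ρ g⁻¹) (ρ x v) = ρ x ((∑ g, f g • ρ g⁻¹) v) := by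
    intro x v
    simp only [LinearMap.sum_apply, LinearMap.smul_apply, map_sum, map_smul]
    refine Fintype.sum_equiv (MulAut.conj x⁻¹).toEquiv _ _ fun g => ?_
    have e : (MulAut.conj x⁻¹).toEquiv g = x⁻¹ * g * x⁻¹⁻¹ := rfl
    rw [e, hf, ← Module.End.mul_apply, ← Module.End.mul_apply, ← map_mul, ← map_mul]
    congr 3
    group
  let T : IntertwiningMap ρ ρ := ⟨∑ g, f g • ρ g⁻¹, fun x => by
    ext v; exact hcomm x v⟩
  obtain ⟨c, hc⟩ := (IsIrreducible.algebraMap_intertwiningMap_bijective_of_isAlgClosed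
    (ρ := ρ)).2 T
  have h1 : ∑ g, f g • ρ g⁻¹ = c • LinearMap.id := by
    have : T.toLinearMap = c • LinearMap.id := by
      rw [← hc, Algebra.algebraMap_eq_smul_one]; rfl
    exact this
  refine ⟨c, h1, ?_⟩
  have := congrArg (LinearMap.trace ℂ V) h1
  simp only [map_sum, map_smul, LinearMap.trace_id, smul_eq_mul] at this
  rw [← this]
  rfl

end Schur

theorem Representation.IsIrreducible.nontrivial' {G V : Type*} [Group G] [AddCommGroup V]
    [Module ℂ V] {ρ : Representation ℂ G V} (hρ : ρ.IsIrreducible) : Nontrivial V := by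
  by_contra h
  rw [not_nontrivial_iff_subsingleton] at h
  obtain ⟨σ, τ, hστ⟩ := hρ.toNontrivial
  exact hστ (Subrepresentation.toSubmodule_injective (Subsingleton.elim _ _))

namespace Irr

variable {G : Type*} [Group G]

theorem exists_rep (χ : Irr G) : ∃ (n : ℕ) (_ : n ≠ 0) (ρ : Representation ℂ G (Fin n → ℂ)),
    ρ.IsIrreducible ∧ ρ.character = χ.1 := by
  obtain ⟨n, ρ, hρ, h⟩ := χ.2
  refine ⟨n, ?_, ρ, hρ, h⟩
  rintro rfl
  have := hρ.nontrivial'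
  exact false_of_nontrivial_of_subsingleton (Fin 0 → ℂ)

theorem exists_one_eq (χ : Irr G) : ∃ n : ℕ, n ≠ 0 ∧ χ 1 = n := by
  obtain ⟨n, hn, ρ, hρ, h⟩ := χ.exists_rep
  exact ⟨n, hn, by rw [← h]; simp⟩

theorem one_ne_zero (χ : Irr G) : χ 1 ≠ 0 := by
  obtain ⟨n, hn, h⟩ := χ.exists_one_eq
  rw [h]
  exact_mod_cast hn

theorem isClassFunction_sigmaChar (X : Set (Irr G)) : IsClassFunction (sigmaChar X) := by
  intro g x
  simp only [sigmaChar]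
  exact finsum_congr fun ψ => finsum_congr fun _ => by rw [ψ.isClassFunction g x]

/-- The multiplicity of an irreducible character in the restriction of an irreducible character
is a natural number. -/
theorem characterInner_comp_eq_natCast {A : Type*} [Group A] [Finite A] (ι : A →* G) (χ : Irr G)
    (ψ : Irr A) : ∃ n : ℕ, characterInner (fun a => χ (ι a)) ψ.1 = n := by
  have := Fintype.ofFinite A
  have : Invertible (Nat.card A : ℂ) :=
    invertibleOfNonzero (by exact_mod_cast Nat.card_pos.ne')
  obtain ⟨n, ρ, hρ, h⟩ := χ.2
  obtain ⟨m, τ, hτ, h'⟩ := ψ.2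
  refine ⟨Module.finrank ℂ (IntertwiningMap τ (ρ.comp ι)), ?_⟩
  rw [← Representation.card_inv_mul_sum_char_mul_char_eq_finrank, characterInner,
    finsum_eq_sum_of_fintype, ← h, ← h']
  rfl

variable [Finite G]

/-- A class function acts on a representation with irreducible character `χ` through the central
character of `χ`. -/
theorem sum_smul_eq_centralChar [Fintype G] (χ : Irr G) {n : ℕ} {ρ : Representation ℂ G (Fin n → ℂ)}
    (hρ : ρ.IsIrreducible) (h : ρ.character = χ.1) {f : G → ℂ} (hf : IsClassFunction f) :
    ∑ g, f g • ρ g⁻¹ = χ.centralChar f • LinearMap.id := by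
  obtain ⟨c, hc, hc'⟩ := ρ.sum_classFunction_smul_eq hρ hf
  have h1 : χ 1 = Module.finrank ℂ (Fin n → ℂ) := by rw [← h]; simp
  rw [hc, centralChar_apply, ← h, ← hc', h, h1, mul_comm c, inv_mul_cancel_left₀]
  rw [← h1]
  exact χ.one_ne_zero

/-- Central characters are multiplicative. -/
theorem centralChar_convolution (χ : Irr G) {f h : G → ℂ} (hf : IsClassFunction f)
    (hh : IsClassFunction h) (hfh : IsClassFunction (convolution f h)) :
    χ.centralChar (convolution f h) = χ.centralChar f * χ.centralChar h := by
  have := Fintype.ofFinite G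
  obtain ⟨n, hn, ρ, hρ, e⟩ := χ.exists_rep
  have h1 := χ.sum_smul_eq_centralChar hρ e hf
  have h2 := χ.sum_smul_eq_centralChar hρ e hh
  have h3 := χ.sum_smul_eq_centralChar hρ e hfh
  have key : ∑ g, convolution f h g • ρ g⁻¹ = (∑ g, h g • ρ g⁻¹) * ∑ g, f g • ρ g⁻¹ := by
    simp only [convolution, finsum_eq_sum_of_fintype, Finset.sum_smul, Finset.mul_sum,
      Finset.sum_mul]
    rw [Finset.sum_comm]
    refine Finset.sum_congr rfl fun y _ => ?_
    refine Fintype.sum_equiv (Equiv.mulLeft y⁻¹) _ _ fun x => ?_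
    simp only [Equiv.coe_mulLeft, smul_mul_smul_comm, ← map_mul]
    rw [mul_comm (f y)]
    congr 2
    group
  rw [h1, h2, h3] at key
  have : Nonempty (Fin n) := ⟨⟨0, Nat.pos_of_ne_zero hn⟩⟩
  have := congrFun (LinearMap.congr_fun key (fun _ => 1)) ⟨0, Nat.pos_of_ne_zero hn⟩
  simpa [mul_comm] using this

/-- The character of an irreducible representation on any finite-dimensional space. -/
def ofRepresentation {V : Type*} [AddCommGroup V] [Module ℂ V] [FiniteDimensional ℂ V]
    (ρ : Representation ℂ G V) (hρ : ρ.IsIrreducible) : Irr G :=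
  ⟨ρ.character, by
    let b := Module.finBasis ℂ V
    let τ : Representation ℂ G (Fin (Module.finrank ℂ V) → ℂ) :=
      (b.equivFun.conjRingEquiv : _ →* _).comp ρ
    let e : ρ.Equiv τ := Representation.Equiv.mk b.equivFun (by intro g; ext v; simp [τ])
    exact ⟨_, τ, e.isIrreducible hρ, (Representation.char_iso e).symm⟩⟩

/-- By Maschke's theorem, a class function killed by all central characters acts as zero on every
representation. -/
theorem sum_smul_eq_zero_of_centralChar [Fintype G] {f : G → ℂ} (hf : IsClassFunction f)
    (h : ∀ χ : Irr G, χ.centralChar f = 0) {V : Type*} [AddCommGroup V] [Module ℂ V]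
    [FiniteDimensional ℂ V] (ρ : Representation ℂ G V) : ∑ g, f g • ρ g⁻¹ = 0 := by
  induction hn : Module.finrank ℂ V using Nat.strong_induction_on generalizing V with
  | _ n ih =>
  have : NeZero (Nat.card G : ℂ) := ⟨by exact_mod_cast Nat.card_pos.ne'⟩
  by_cases hV : Subsingleton V
  · exact Subsingleton.elim _ _
  rw [not_subsingleton_iff_nontrivial] at hV
  by_cases hρ : ρ.IsIrreducible
  · obtain ⟨c, hc, hc'⟩ := ρ.sum_classFunction_smul_eq hρ hf
    have h1 := h (ofRepresentation ρ hρ)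
    rw [centralChar_apply] at h1
    have h2 : ∑ g, f g * ρ.character g⁻¹ = 0 :=
      (mul_eq_zero.1 h1).resolve_left (inv_ne_zero (ofRepresentation ρ hρ).one_ne_zero)
    rw [h2] at hc'
    have h3 : (Module.finrank ℂ V : ℂ) ≠ 0 := by exact_mod_cast Module.finrank_pos.ne'
    rw [hc, (mul_eq_zero.1 hc').resolve_right h3, zero_smul]
  · obtain ⟨σ, hσ1, hσ2⟩ : ∃ σ : Subrepresentation ρ, σ ≠ ⊥ ∧ σ ≠ ⊤ := by
      by_contra! hcon
      have : Nontrivial (Subrepresentation ρ) := ⟨⊥, ⊤, fun e => bot_ne_top (α := Submodule ℂ V)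
        (congrArg Subrepresentation.toSubmodule e)⟩
      exact hρ ⟨fun σ => or_iff_not_imp_left.2 (hcon σ)⟩
    obtain ⟨τ, hστ⟩ := exists_isCompl σ
    have hτ2 : τ ≠ ⊤ := fun e => hσ1 (by simpa [e] using hστ.inf_eq_bot)
    have aux : ∀ κ : Subrepresentation ρ, κ ≠ ⊤ → ∀ v ∈ κ.toSubmodule,
        (∑ g, f g • ρ g⁻¹) v = 0 := by
      intro κ hκ v hv
      have hlt : Module.finrank ℂ κ.toSubmodule < n := by
        rw [← hn]
        exact Submodule.finrank_lt fun e => hκ (Subrepresentation.toSubmodule_injective e)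
      have h1 := LinearMap.congr_fun (ih _ hlt κ.toRepresentation rfl) ⟨v, hv⟩
      have h2 := congrArg Subtype.val h1
      simpa [LinearMap.sum_apply, Subrepresentation.toRepresentation] using h2
    ext v
    have hv : v ∈ σ.toSubmodule ⊔ τ.toSubmodule := by
      rw [← Subrepresentation.toSubmodule_sup, hστ.sup_eq_top]
      exact Submodule.mem_top
    obtain ⟨a, ha, b, hb, rfl⟩ := Submodule.mem_sup.1 hv
    rw [map_add, aux σ hσ2 a ha, aux τ hτ2 b hb, add_zero, LinearMap.zero_apply]

/-- Completeness of the irreducible characters: a class function killed by all central characters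
vanishes, since it acts as zero on the regular representation. -/
theorem eq_zero_of_centralChar {f : G → ℂ} (hf : IsClassFunction f)
    (h : ∀ χ : Irr G, χ.centralChar f = 0) : f = 0 := by
  classical
  have := Fintype.ofFinite G
  let ρ : Representation ℂ G (G → ℂ) :=
    { toFun := fun g => LinearMap.funLeft ℂ ℂ (· * g)
      map_one' := by ext; simp [LinearMap.funLeft]
      map_mul' := fun g h => by ext; simp [LinearMap.funLeft, mul_assoc] }
  have h0 := sum_smul_eq_zero_of_centralChar hf h ρ
  ext x
  have h1 := congrFun (LinearMap.congr_fun h0 (Pi.single 1 1)) x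
  have h2 : ∀ g, (ρ g⁻¹) (Pi.single 1 1) x = if g = x then 1 else 0 := by
    intro g
    have : (ρ g⁻¹) (Pi.single 1 1) x = Pi.single (M := fun _ => ℂ) 1 1 (x * g⁻¹) := rfl
    rw [this, Pi.single_apply]
    simp only [mul_inv_eq_one, eq_comm]
  simpa [LinearMap.sum_apply, Finset.sum_apply, h2] using h1

theorem eq_of_centralChar_eq {f h : G → ℂ} (hf : IsClassFunction f) (hh : IsClassFunction h)
    (e : ∀ χ : Irr G, χ.centralChar f = χ.centralChar h) : f = h := by
  refine sub_eq_zero.1 (eq_zero_of_centralChar (fun g x => ?_) fun χ => ?_)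
  · simp only [Pi.sub_apply, hf g x, hh g x]
  · rw [map_sub, e, sub_self]

theorem centralChar_irr [DecidableEq (Irr G)] (χ ψ : Irr G) :
    χ.centralChar ψ.1 = if χ = ψ then (Nat.card G : ℂ) * (χ 1)⁻¹ else 0 := by
  have hG : (Nat.card G : ℂ) ≠ 0 := by exact_mod_cast Nat.card_pos.ne'
  have h1 : χ.centralChar ψ.1 = (χ 1)⁻¹ * (Nat.card G * characterInner ψ.1 χ.1) := by
    rw [characterInner, mul_inv_cancel_left₀ hG]; rfl
  rw [h1]
  split_ifs with h
  · rw [(characterInner_irr ψ χ).1 h.symm]; ring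
  · rw [(characterInner_irr ψ χ).2 (Ne.symm h)]; ring

/-- `ω_χ(σ_X)` is `|G|` for `χ ∈ X` and zero otherwise. -/
theorem centralChar_sigmaChar (X : Set (Irr G)) [DecidablePred (· ∈ X)] (χ : Irr G) :
    χ.centralChar (sigmaChar X) = if χ ∈ X then (Nat.card G : ℂ) else 0 := by
  classical
  have := Fintype.ofFinite (Irr G)
  have h1 : sigmaChar X = ∑ ψ : Irr G, (if ψ ∈ X then ψ 1 else 0) • ψ.1 := by
    ext g
    simp only [sigmaChar, finsum_eq_if, Finset.sum_apply, Pi.smul_apply, smul_eq_mul, ite_mul,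
      zero_mul]
    rw [finsum_eq_sum_of_fintype]
  rw [h1, map_sum]
  simp only [map_smul, centralChar_irr, smul_eq_mul, mul_ite, mul_zero]
  rw [Finset.sum_ite_eq Finset.univ χ]
  have := χ.one_ne_zero
  simp only [Finset.mem_univ, if_true]
  split_ifs
  · field_simp
  · simp

theorem centralChar_sigmaChar_ne_zero_iff (X : Set (Irr G)) (χ : Irr G) :
    χ.centralChar (sigmaChar X) ≠ 0 ↔ χ ∈ X := by
  classical
  have hG : (Nat.card G : ℂ) ≠ 0 := by exact_mod_cast Nat.card_pos.ne'
  rw [centralChar_sigmaChar, Ne, ite_eq_right_iff, Classical.not_imp]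
  exact and_iff_left hG

theorem centralChar_single_one [DecidableEq G] (χ : Irr G) :
    χ.centralChar (Pi.single 1 1) = 1 := by
  have := Fintype.ofFinite G
  rw [centralChar_apply, Fintype.sum_eq_single 1 fun g hg => by simp [hg]]
  simp [χ.one_ne_zero]

end Irr

end

/-! ### Supercharacter theories as algebras of functions -/

/-- The functions that are constant on every member of a family of sets. -/
def constOn {α : Type*} (𝒮 : Set (Set α)) : Submodule ℂ (α → ℂ) where
  carrier := {f | ∀ K ∈ 𝒮, ∀ x ∈ K, ∀ y ∈ K, f x = f y}
  add_mem' hf hh K hK x hx y hy := by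
    simp only [Pi.add_apply, hf K hK x hx y hy, hh K hK x hx y hy]
  zero_mem' _ _ _ _ _ _ := rfl
  smul_mem' c f hf K hK x hx y hy := by simp only [Pi.smul_apply, hf K hK x hx y hy]

namespace Setoid.IsPartition

variable {α : Type*} {𝒮 : Set (Set α)}

theorem eq_of_mem (h : Setoid.IsPartition 𝒮) {K L : Set α} (hK : K ∈ 𝒮) (hL : L ∈ 𝒮) {x : α}
    (hx : x ∈ K) (hx' : x ∈ L) : K = L :=
  (h.2 x).unique ⟨hK, hx⟩ ⟨hL, hx'⟩

theorem exists_mem (h : Setoid.IsPartition 𝒮) (x : α) : ∃ K ∈ 𝒮, x ∈ K :=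
  (h.2 x).exists

theorem nonempty (h : Setoid.IsPartition 𝒮) {K : Set α} (hK : K ∈ 𝒮) : K.Nonempty :=
  Setoid.nonempty_of_mem_partition h hK

theorem of_forall (hne : ∀ K ∈ 𝒮, K.Nonempty) (hex : ∀ x, ∃ K ∈ 𝒮, x ∈ K)
    (huniq : ∀ K ∈ 𝒮, ∀ L ∈ 𝒮, ∀ x ∈ K, x ∈ L → K = L) : Setoid.IsPartition 𝒮 := by
  refine ⟨fun h => Set.not_nonempty_empty (hne _ h), fun x => ?_⟩
  obtain ⟨K, hK, hx⟩ := hex x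
  exact ⟨K, ⟨hK, hx⟩, fun L hL => huniq L hL.1 K hK x hL.2 hx⟩

/-- A partition that is contained in another one is equal to it. -/
theorem eq_of_subset {𝒬 : Set (Set α)} (h : Setoid.IsPartition 𝒮) (h' : Setoid.IsPartition 𝒬)
    (hs : 𝒮 ⊆ 𝒬) : 𝒮 = 𝒬 := by
  refine hs.antisymm fun K hK => ?_
  obtain ⟨x, hx⟩ := h'.nonempty hK
  obtain ⟨L, hL, hx'⟩ := h.exists_mem x
  rwa [h'.eq_of_mem hK (hs hL) hx hx']

theorem indicator_mem_constOn (h : Setoid.IsPartition 𝒮) {K : Set α} (hK : K ∈ 𝒮) :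
    K.indicator 1 ∈ constOn 𝒮 := by
  classical
  intro L hL y hy z hz
  have : y ∈ K ↔ z ∈ K :=
    ⟨fun h' => by rwa [h.eq_of_mem hK hL h' hy], fun h' => by rwa [h.eq_of_mem hK hL h' hz]⟩
  simp only [Set.indicator_apply, this, Pi.one_apply]

theorem finrank_constOn [Finite α] (h : Setoid.IsPartition 𝒮) :
    Module.finrank ℂ (constOn 𝒮) = 𝒮.ncard := by
  classical
  have : Fintype 𝒮 := Fintype.ofFinite _
  choose c hc hxc using h.exists_mem
  let Φ : (𝒮 → ℂ) →ₗ[ℂ] (α → ℂ) := LinearMap.funLeft ℂ ℂ fun x => ⟨c x, hc x⟩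
  have hΦ : Function.Injective Φ := by
    refine LinearMap.funLeft_injective_of_surjective _ _ _ ?_
    rintro ⟨K, hK⟩
    obtain ⟨x, hx⟩ := h.nonempty hK
    exact ⟨x, Subtype.ext (h.eq_of_mem (hc x) hK (hxc x) hx)⟩
  have hr : LinearMap.range Φ = constOn 𝒮 := by
    ext f
    constructor
    · rintro ⟨u, rfl⟩ K hK x hx y hy
      have : c x = c y := (h.eq_of_mem (hc x) hK (hxc x) hx).trans
        (h.eq_of_mem (hc y) hK (hxc y) hy).symm
      exact congrArg u (Subtype.ext this)
    · intro hf
      refine ⟨fun K => f (h.nonempty K.2).choose, ?_⟩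
      ext x
      exact hf _ (hc x) _ (h.nonempty (hc x)).choose_spec _ (hxc x)
  rw [← hr, LinearMap.finrank_range_of_inj hΦ, Module.finrank_fintype_fun_eq_card,
    ← Nat.card_eq_fintype_card, Nat.card_coe_set_eq]

/-- The functions constant on the parts of a partition are spanned by the indicators of parts. -/
theorem constOn_le [Finite α] (h : Setoid.IsPartition 𝒮) {p : Submodule ℂ (α → ℂ)}
    (hp : ∀ K ∈ 𝒮, K.indicator 1 ∈ p) : constOn 𝒮 ≤ p := by
  classical
  have : Fintype 𝒮 := Fintype.ofFinite _
  intro f hf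
  have : f = ∑ K : 𝒮, f (h.nonempty K.2).choose • K.1.indicator 1 := by
    ext x
    obtain ⟨K, hK, hx⟩ := h.exists_mem x
    rw [Finset.sum_apply, Fintype.sum_eq_single ⟨K, hK⟩]
    · simp only [Pi.smul_apply, Set.indicator_of_mem hx, Pi.one_apply, smul_eq_mul, mul_one]
      exact hf K hK _ hx _ (h.nonempty hK).choose_spec
    · rintro ⟨L, hL⟩ hne
      have : x ∉ L := fun hx' => hne (Subtype.ext (h.eq_of_mem hL hK hx' hx))
      simp [this]
  rw [this]
  exact Submodule.sum_mem _ fun K _ => Submodule.smul_mem _ _ (hp K K.2)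

/-- A family of at least as many pairwise disjoint nonempty unions of parts as there are parts
consists of the parts. -/
theorem eq_of_ncard_le [Finite α] (h : Setoid.IsPartition 𝒮) {F : Set (Set α)}
    (hne : ∀ Z ∈ F, Z.Nonempty) (hdisj : ∀ Z ∈ F, ∀ Z' ∈ F, ∀ x ∈ Z, x ∈ Z' → Z = Z')
    (hunion : ∀ Z ∈ F, ∀ K ∈ 𝒮, ∀ x ∈ K, ∀ y ∈ K, x ∈ Z → y ∈ Z)
    (hcard : 𝒮.ncard ≤ F.ncard) : F = 𝒮 := by
  classical
  have : Fintype 𝒮 := Fintype.ofFinite _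
  have : Fintype F := Fintype.ofFinite _
  have hex : ∀ Z : F, ∃ K : 𝒮, K.1 ⊆ Z.1 := by
    rintro ⟨Z, hZ⟩
    obtain ⟨x, hx⟩ := hne Z hZ
    obtain ⟨K, hK, hxK⟩ := h.exists_mem x
    exact ⟨⟨K, hK⟩, fun y hy => hunion Z hZ K hK x hxK y hy hx⟩
  choose p hp using hex
  have hinj : Function.Injective p := by
    intro Z Z' e
    obtain ⟨x, hx⟩ := h.nonempty (p Z).2
    exact Subtype.ext (hdisj _ Z.2 _ Z'.2 x (hp Z hx) (hp Z' (e ▸ hx)))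
  have hbij : Function.Bijective p := by
    rw [Fintype.bijective_iff_injective_and_card]
    refine ⟨hinj, le_antisymm (Fintype.card_le_of_injective p hinj) ?_⟩
    rwa [← Nat.card_eq_fintype_card, ← Nat.card_eq_fintype_card, Nat.card_coe_set_eq,
      Nat.card_coe_set_eq]
  have heq : ∀ Z : F, Z.1 = (p Z).1 := by
    intro Z
    refine Set.Subset.antisymm (fun x hx => ?_) (hp Z)
    obtain ⟨K, hK, hxK⟩ := h.exists_mem x
    obtain ⟨Z', hZ'⟩ := hbij.2 ⟨K, hK⟩
    have : Z' = Z := by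
      refine Subtype.ext (hdisj _ Z'.2 _ Z.2 x (hp Z' ?_) hx)
      rw [hZ']; exact hxK
    rw [← this, hZ']; exact hxK
  refine Set.eq_of_subset_of_ncard_le (fun Z hZ => ?_) hcard
  have := heq ⟨Z, hZ⟩
  change Z = _ at this
  rw [this]
  exact (p _).2

end Setoid.IsPartition

/-- The relation of not being separated by an algebra of functions. -/
def Subalgebra.unseparated {α : Type*} (B : Subalgebra ℂ (α → ℂ)) : Setoid α where
  r x y := ∀ f ∈ B, f x = f y
  iseqv := ⟨fun _ _ _ => rfl, fun h f hf => (h f hf).symm,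
    fun h h' f hf => (h f hf).trans (h' f hf)⟩

/-- An algebra of functions on a finite set consists of all functions that are constant on the
sets of points that it does not separate. -/
theorem Subalgebra.toSubmodule_eq_constOn {α : Type*} [Finite α] (B : Subalgebra ℂ (α → ℂ)) :
    Subalgebra.toSubmodule B = constOn B.unseparated.classes := by
  classical
  have := Fintype.ofFinite α
  apply le_antisymm
  · rintro f hf K ⟨z, rfl⟩ x hx y hy
    exact (hx f hf).trans (hy f hf).symm
  refine (Setoid.isPartition_classes _).constOn_le ?_
  rintro K ⟨z, rfl⟩
  -- The indicator of the class of `z` is the product over all `x` of members of `B` that are `1`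
  -- at `z` and vanish at `x` unless `x` lies in that class.
  have hex : ∀ x, ∃ f ∈ B, f z = 1 ∧ (¬ B.unseparated x z → f x = 0) := by
    intro x
    by_cases hx : B.unseparated x z
    · exact ⟨1, B.one_mem, rfl, fun h => absurd hx h⟩
    · have : ∃ f ∈ B, f x ≠ f z := by
        by_contra! hcon
        exact hx hcon
      obtain ⟨f, hf, hne⟩ := this
      refine ⟨(f z - f x)⁻¹ • (f - algebraMap ℂ (α → ℂ) (f x)),
        B.smul_mem (B.sub_mem hf (B.algebraMap_mem _)) _, ?_, fun _ => ?_⟩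
      · simp only [Pi.smul_apply, Pi.sub_apply, Pi.algebraMap_apply, Algebra.algebraMap_self,
          RingHom.id_apply, smul_eq_mul]
        exact inv_mul_cancel₀ (sub_ne_zero.2 (Ne.symm hne))
      · simp
  choose f hfB hfz hfx using hex
  have : Set.indicator {x | B.unseparated x z} 1 = ∏ x, f x := by
    ext y
    rw [Finset.prod_apply]
    by_cases hy : B.unseparated y z
    · rw [Set.indicator_of_mem (by exact hy), Finset.prod_eq_one fun x _ => ?_]
      · rfl
      · rw [hy _ (hfB x), hfz]
    · rw [Set.indicator_of_notMem (by exact hy),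
        Finset.prod_eq_zero (f := fun x => f x y) (Finset.mem_univ y) (hfx y hy)]
  rw [Subalgebra.mem_toSubmodule]
  erw [this]
  exact B.prod_mem fun x _ => hfB x

/-- The class function with prescribed values `u χ` under the central characters. -/
def classFunctionOf (G : Type*) [Group G] [Finite G] : (Irr G → ℂ) →ₗ[ℂ] (G → ℂ) where
  toFun u g := (Nat.card G : ℂ)⁻¹ * ∑ᶠ χ : Irr G, u χ * (χ 1 * χ g)
  map_add' u v := by
    have := Fintype.ofFinite (Irr G)
    ext g
    simp only [finsum_eq_sum_of_fintype, Pi.add_apply, add_mul, Finset.sum_add_distrib, mul_add]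
  map_smul' c u := by
    have := Fintype.ofFinite (Irr G)
    ext g
    simp only [finsum_eq_sum_of_fintype, Pi.smul_apply, smul_eq_mul, Finset.mul_sum,
      RingHom.id_apply]
    exact Finset.sum_congr rfl fun g _ => by ring

section

variable {G : Type*} [Group G] [Finite G]

theorem isClassFunction_classFunctionOf (u : Irr G → ℂ) :
    IsClassFunction (classFunctionOf G u) := by
  intro g x
  refine congrArg (fun z => (Nat.card G : ℂ)⁻¹ * z) ?_
  exact finsum_congr fun χ => by rw [χ.isClassFunction g x]

theorem classFunctionOf_indicator (X : Set (Irr G)) :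
    classFunctionOf G (X.indicator 1) = (Nat.card G : ℂ)⁻¹ • sigmaChar X := by
  ext g
  refine congrArg (fun z => (Nat.card G : ℂ)⁻¹ * z) ?_
  simp only [sigmaChar, finsum_mem_def]
  refine finsum_congr fun χ => ?_
  by_cases h : χ ∈ X <;> simp [h]

theorem centralChar_classFunctionOf (u : Irr G → ℂ) (χ : Irr G) :
    χ.centralChar (classFunctionOf G u) = u χ := by
  classical
  have := Fintype.ofFinite (Irr G)
  have hG : (Nat.card G : ℂ) ≠ 0 := by exact_mod_cast Nat.card_pos.ne'
  have h1 : u = ∑ ψ, u ψ • Set.indicator {ψ} 1 := by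
    ext φ
    rw [Finset.sum_apply, Fintype.sum_eq_single φ fun ψ hψ => by simp [hψ.symm]]
    simp
  conv_lhs => rw [h1]
  simp only [map_sum, map_smul, classFunctionOf_indicator, Irr.centralChar_sigmaChar,
    Set.mem_singleton_iff, smul_eq_mul]
  rw [Fintype.sum_eq_single χ fun ψ hψ => by simp [hψ.symm]]
  simp [hG]

theorem classFunctionOf_centralChar {f : G → ℂ} (hf : IsClassFunction f) :
    classFunctionOf G (fun χ => χ.centralChar f) = f :=
  Irr.eq_of_centralChar_eq (isClassFunction_classFunctionOf _) hf
    fun χ => centralChar_classFunctionOf _ χ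

theorem classFunctionOf_injective : Function.Injective (classFunctionOf G) := by
  intro u v h
  ext χ
  rw [← centralChar_classFunctionOf u, h, centralChar_classFunctionOf]

namespace SupercharacterTheory

/-- The functions constant on superclasses are the class functions on which the central characters
in each part of the partition of `Irr(G)` agree. Both spaces have dimension `|𝒳| = |𝒦|`, and the
second one is spanned by the `σ_X`. -/
theorem constOn_classes (C : SupercharacterTheory G) :
    constOn C.classes = (constOn C.chars).map (classFunctionOf G) := by
  symm
  refine Submodule.eq_of_le_of_finrank_eq ?_ ?_
  · rw [Submodule.map_le_iff_le_comap]
    refine C.chars_isPartition.constOn_le fun X hX => ?_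
    rw [Submodule.mem_comap, classFunctionOf_indicator]
    exact Submodule.smul_mem _ _ (C.sigma_const X hX)
  · rw [(Submodule.equivMapOfInjective _ classFunctionOf_injective _).symm.finrank_eq,
      C.chars_isPartition.finrank_constOn, C.classes_isPartition.finrank_constOn, C.ncard_eq]

theorem isClassFunction (C : SupercharacterTheory G) {f : G → ℂ} (hf : f ∈ constOn C.classes) :
    IsClassFunction f := by
  rw [C.constOn_classes] at hf
  obtain ⟨u, -, rfl⟩ := hf
  exact isClassFunction_classFunctionOf u

theorem mem_constOn_classes_iff (C : SupercharacterTheory G) {f : G → ℂ} :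
    f ∈ constOn C.classes ↔ IsClassFunction f ∧ (fun χ => χ.centralChar f) ∈ constOn C.chars := by
  rw [C.constOn_classes]
  constructor
  · rintro ⟨u, hu, rfl⟩
    simp only [centralChar_classFunctionOf]
    exact ⟨isClassFunction_classFunctionOf u, hu⟩
  · rintro ⟨h1, h2⟩
    exact ⟨_, h2, classFunctionOf_centralChar h1⟩

end SupercharacterTheory

theorem IsClassFunction.convolution {G : Type*} [Group G] {f h : G → ℂ} (hf : IsClassFunction f)
    (hh : IsClassFunction h) : IsClassFunction (convolution f h) := by
  intro g x
  simp only [_root_.convolution]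
  refine finsum_eq_of_bijective (MulAut.conj x⁻¹) (MulAut.conj x⁻¹).bijective fun y => ?_
  have e : MulAut.conj x⁻¹ y = x⁻¹ * y * x⁻¹⁻¹ := rfl
  rw [e, hf y x⁻¹, ← hh (y⁻¹ * _) x⁻¹]
  congr 2
  group

theorem convolution_classFunctionOf (u v : Irr G → ℂ) :
    convolution (classFunctionOf G u) (classFunctionOf G v) = classFunctionOf G (u * v) := by
  have h1 := isClassFunction_classFunctionOf u
  have h2 := isClassFunction_classFunctionOf v
  refine Irr.eq_of_centralChar_eq (h1.convolution h2) (isClassFunction_classFunctionOf _)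
    fun χ => ?_
  rw [χ.centralChar_convolution h1 h2 (h1.convolution h2)]
  simp only [centralChar_classFunctionOf, Pi.mul_apply]

theorem classFunctionOf_one [DecidableEq G] : classFunctionOf G 1 = Pi.single 1 1 := by
  refine Irr.eq_of_centralChar_eq (isClassFunction_classFunctionOf _) (fun g x => ?_) fun χ => ?_
  · simp only [Pi.single_apply, conj_eq_one_iff]
  · rw [centralChar_classFunctionOf, χ.centralChar_single_one, Pi.one_apply]

namespace SupercharacterTheory

theorem convolution_mem (C : SupercharacterTheory G) {f h : G → ℂ} (hf : f ∈ constOn C.classes)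
    (hh : h ∈ constOn C.classes) : convolution f h ∈ constOn C.classes := by
  rw [C.constOn_classes] at *
  obtain ⟨u, hu, rfl⟩ := hf
  obtain ⟨v, hv, rfl⟩ := hh
  rw [convolution_classFunctionOf]
  refine ⟨_, fun X hX χ hχ ψ hψ => ?_, rfl⟩
  exact congrArg₂ (· * ·) (hu X hX χ hχ ψ hψ) (hv X hX χ hχ ψ hψ)

theorem conj_mem (C : SupercharacterTheory G) {K : Set G} (hK : K ∈ C.classes) {g : G}
    (hg : g ∈ K) (x : G) : x * g * x⁻¹ ∈ K := by
  have h1 := C.classes_isPartition.indicator_mem_constOn hK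
  have h2 := C.isClassFunction h1 g x
  by_contra h
  rw [Set.indicator_of_mem hg, Set.indicator_of_notMem h] at h2
  exact zero_ne_one h2

/-- A partition of a group containing `{1}` is the set of superclasses of a supercharacter theory
if the functions constant on its parts are class functions and closed under convolution. Under the
central characters these functions form an algebra of functions on `Irr(G)`, and the sets that this
algebra does not separate are the required sets of characters. -/
theorem exists_of_convolution_mem {𝒦 : Set (Set G)} (hpart : Setoid.IsPartition 𝒦)
    (hone : {1} ∈ 𝒦) (hclass : ∀ f ∈ constOn 𝒦, IsClassFunction f)
    (hconv : ∀ f ∈ constOn 𝒦, ∀ h ∈ constOn 𝒦, convolution f h ∈ constOn 𝒦) :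
    ∃ C : SupercharacterTheory G, C.classes = 𝒦 := by
  classical
  have hδ : Pi.single 1 1 ∈ constOn 𝒦 := by
    intro K hK x hx y hy
    by_cases h : (1 : G) ∈ K
    · rw [hpart.eq_of_mem hK hone h rfl] at hx hy
      rw [Set.mem_singleton_iff.1 hx, Set.mem_singleton_iff.1 hy]
    · rw [Pi.single_eq_of_ne (by rintro rfl; exact h hx),
        Pi.single_eq_of_ne (by rintro rfl; exact h hy)]
  let B : Subalgebra ℂ (Irr G → ℂ) :=
    { carrier := {u | classFunctionOf G u ∈ constOn 𝒦}
      mul_mem' := fun {u v} hu hv => by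
        rw [Set.mem_ofPred_eq, ← convolution_classFunctionOf]
        exact hconv _ hu _ hv
      add_mem' := fun {u v} hu hv => by
        rw [Set.mem_ofPred_eq, map_add]
        exact Submodule.add_mem _ hu hv
      algebraMap_mem' := fun c => by
        rw [Set.mem_ofPred_eq, Algebra.algebraMap_eq_smul_one, map_smul, classFunctionOf_one]
        exact Submodule.smul_mem _ _ hδ }
  have hB : ∀ u, u ∈ constOn B.unseparated.classes ↔ classFunctionOf G u ∈ constOn 𝒦 := by
    intro u
    rw [← B.toSubmodule_eq_constOn]
    rfl
  have hmap : constOn 𝒦 = (constOn B.unseparated.classes).map (classFunctionOf G) := by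
    ext f
    constructor
    · intro hf
      have e := classFunctionOf_centralChar (hclass f hf)
      exact ⟨_, (hB _).2 (e.symm ▸ hf), e⟩
    · rintro ⟨u, hu, rfl⟩
      exact (hB u).1 hu
  have hX := Setoid.isPartition_classes B.unseparated
  refine ⟨⟨⟨B.unseparated.classes, 𝒦⟩, hX, hpart, hone, ?_, fun X hXm => ?_⟩, rfl⟩
  · show B.unseparated.classes.ncard = 𝒦.ncard
    rw [← hX.finrank_constOn, ← hpart.finrank_constOn, hmap,
      (Submodule.equivMapOfInjective _ classFunctionOf_injective _).symm.finrank_eq]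
  · have h1 := hX.indicator_mem_constOn hXm
    rw [hB, classFunctionOf_indicator] at h1
    have hG : (Nat.card G : ℂ) ≠ 0 := by exact_mod_cast Nat.card_pos.ne'
    exact (Submodule.smul_mem_iff _ (inv_ne_zero hG)).1 h1

/-- The sets of characters of a supercharacter theory can be recognized by counting: they are the
members of any sufficiently large family of pairwise disjoint nonempty sets that are unions of
parts. Every set of the form `{χ | ω_χ(f) ≠ 0}`, with `f` constant on superclasses, is such a
union. -/
theorem chars_eq_of_ncard_le (C : SupercharacterTheory G) {F : Set (Set (Irr G))}
    (hne : ∀ Z ∈ F, Z.Nonempty) (hdisj : ∀ Z ∈ F, ∀ Z' ∈ F, ∀ χ ∈ Z, χ ∈ Z' → Z = Z')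
    (hunion : ∀ Z ∈ F, ∃ f ∈ constOn C.classes, ∀ χ : Irr G, χ.centralChar f ≠ 0 ↔ χ ∈ Z)
    (hcard : C.classes.ncard ≤ F.ncard) : C.chars = F := by
  refine (C.chars_isPartition.eq_of_ncard_le hne hdisj (fun Z hZ X hX χ hχ ψ hψ h => ?_) ?_).symm
  · obtain ⟨f, hf, hfZ⟩ := hunion Z hZ
    have h1 := (C.mem_constOn_classes_iff.1 hf).2 X hX χ hχ ψ hψ
    rw [← hfZ] at h ⊢
    exact fun h0 => h (h1.trans h0)
  · rwa [C.ncard_eq]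

/-- The superclasses determine the supercharacter theory. -/
theorem eq_of_classes_eq {C D : SupercharacterTheory G} (h : C.classes = D.classes) : C = D := by
  refine SupercharacterTheory.ext (C.chars_eq_of_ncard_le
    (fun Z hZ => D.chars_isPartition.nonempty hZ)
    (fun Z hZ Z' hZ' χ h h' => D.chars_isPartition.eq_of_mem hZ hZ' h h')
    (fun Z hZ => ⟨sigmaChar Z, h ▸ D.sigma_const Z hZ,
      Irr.centralChar_sigmaChar_ne_zero_iff Z⟩) ?_) h
  rw [h, D.ncard_eq]

end SupercharacterTheory

end

/-! ### Inflation, and extension by zero -/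

namespace Irr

/-- Inflation of irreducible characters along a surjective homomorphism. -/
def inflate {G Q : Type*} [Group G] [Group Q] (π : G →* Q) (hπ : Function.Surjective π)
    (ψ : Irr Q) : Irr G :=
  ⟨fun g => ψ (π g), by
    obtain ⟨n, ρ, hρ, h⟩ := ψ.2
    refine ⟨n, ρ.comp π, ?_, by rw [← h]; rfl⟩
    have := hρ.nontrivial'
    have : Nontrivial (Subrepresentation (ρ.comp π : Representation ℂ G _)) :=
      ⟨⊥, ⊤, fun e => bot_ne_top (α := Submodule ℂ (Fin n → ℂ))
        (congrArg Subrepresentation.toSubmodule e)⟩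
    refine ⟨fun σ => ?_⟩
    let τ : Subrepresentation ρ := ⟨σ.toSubmodule, fun q v hv => by
      obtain ⟨g, rfl⟩ := hπ q
      exact σ.apply_mem_toSubmodule g hv⟩
    have hτ : τ.toSubmodule = ⊥ ∨ τ.toSubmodule = ⊤ :=
      (hρ.eq_bot_or_eq_top τ).imp (congrArg Subrepresentation.toSubmodule)
        (congrArg Subrepresentation.toSubmodule)
    exact hτ.imp (fun h => Subrepresentation.toSubmodule_injective h)
      fun h => Subrepresentation.toSubmodule_injective h⟩

theorem inflate_injective {G Q : Type*} [Group G] [Group Q] (π : G →* Q)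
    (hπ : Function.Surjective π) : Function.Injective (inflate π hπ) := by
  intro ψ φ h
  refine ext' fun q => ?_
  obtain ⟨g, rfl⟩ := hπ q
  exact congrFun (congrArg Subtype.val h) g

theorem inflateChars_eq_image {G Q : Type*} [Group G] [Group Q] (π : G →* Q)
    (hπ : Function.Surjective π) (Y : Set (Irr Q)) : inflateChars π Y = inflate π hπ '' Y := by
  ext χ
  constructor
  · rintro ⟨ψ, hψ, h⟩
    exact ⟨ψ, hψ, ext' fun g => (h g).symm⟩
  · rintro ⟨ψ, hψ, rfl⟩
    exact ⟨ψ, hψ, fun _ => rfl⟩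

theorem sigmaChar_inflateChars {G Q : Type*} [Group G] [Group Q] (π : G →* Q)
    (hπ : Function.Surjective π) (Y : Set (Irr Q)) :
    sigmaChar (inflateChars π Y) = sigmaChar Y ∘ π := by
  ext g
  rw [inflateChars_eq_image π hπ]
  simp only [sigmaChar, Function.comp_apply]
  rw [finsum_mem_image (inflate_injective π hπ).injOn]
  refine finsum_congr fun ψ => finsum_congr fun _ => ?_
  show ψ (π 1) * ψ (π g) = _
  rw [map_one]

/-- The trivial character. -/
def triv (G : Type*) [Group G] : Irr G :=
  ⟨1, 1, 1, by
    have h1 : Nontrivial (Subrepresentation (1 : Representation ℂ G (Fin 1 → ℂ))) :=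
      ⟨⊥, ⊤, fun e => bot_ne_top (α := Submodule ℂ (Fin 1 → ℂ))
        (congrArg Subrepresentation.toSubmodule e)⟩
    refine ⟨fun σ => ?_⟩
    have : IsSimpleOrder (Submodule ℂ (Fin 1 → ℂ)) :=
      (Submodule.orderIsoMapComap (LinearEquiv.funUnique (Fin 1) ℂ ℂ)).isSimpleOrder
    exact (this.eq_bot_or_eq_top σ.toSubmodule).imp
      (fun h => Subrepresentation.toSubmodule_injective h)
      fun h => Subrepresentation.toSubmodule_injective h, by
    ext g
    simp [Representation.character]⟩

theorem triv_apply {G : Type*} [Group G] (g : G) : triv G g = 1 := rfl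

theorem trivialChars_eq (G : Type*) [Group G] : trivialChars G = {triv G} := by
  ext χ
  exact ⟨fun h => ext' h, fun h => by rw [h]; exact fun _ => rfl⟩

end Irr

section Extend

variable {A G : Type*} [Group A] [Finite A] [Group G] [Finite G] {ι : A →* G}

theorem convolution_extend (hι : Function.Injective ι) (f h : A → ℂ) :
    convolution (Function.extend ι f 0) (Function.extend ι h 0) =
      Function.extend ι (convolution f h) 0 := by
  have := Fintype.ofFinite A
  have := Fintype.ofFinite G
  ext x
  have h1 : convolution (Function.extend ι f 0) (Function.extend ι h 0) x =
      ∑ a, f a * Function.extend ι h 0 ((ι a)⁻¹ * x) := by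
    rw [convolution, finsum_eq_sum_of_fintype]
    symm
    refine Fintype.sum_of_injective ι hι _ _ (fun g hg => ?_) fun a => ?_
    · rw [Function.extend_apply' _ _ _ fun ⟨a, ha⟩ => hg ⟨a, ha⟩, Pi.zero_apply, zero_mul]
    · rw [hι.extend_apply]
  rw [h1]
  by_cases hx : ∃ b, ι b = x
  · obtain ⟨b, rfl⟩ := hx
    rw [hι.extend_apply, convolution, finsum_eq_sum_of_fintype]
    refine Finset.sum_congr rfl fun a _ => ?_
    rw [← map_inv, ← map_mul, hι.extend_apply]
  · rw [Function.extend_apply' _ _ _ hx, Pi.zero_apply]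
    refine Finset.sum_eq_zero fun a _ => ?_
    rw [Function.extend_apply', Pi.zero_apply, mul_zero]
    rintro ⟨b, hb⟩
    exact hx ⟨a * b, by rw [map_mul, hb, mul_inv_cancel_left]⟩

/-- The characters above `X` are the ones whose central character does not vanish on the extension
of `σ_X` by zero: up to positive factors, this value is the sum of the multiplicities of the
members of `X` in the restricted character. -/
theorem centralChar_extend_sigmaChar_ne_zero_iff (hι : Function.Injective ι) (X : Set (Irr A))
    (χ : Irr G) :
    χ.centralChar (Function.extend ι (sigmaChar X) 0) ≠ 0 ↔ χ ∈ charsAbove ι X := by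
  classical
  have := Fintype.ofFinite A
  have := Fintype.ofFinite G
  have := Fintype.ofFinite (Irr A)
  have hA : (Nat.card A : ℂ) ≠ 0 := by exact_mod_cast Nat.card_pos.ne'
  choose m hm using fun ψ => Irr.characterInner_comp_eq_natCast ι χ ψ
  choose d hd0 hd using fun ψ : Irr A => ψ.exists_one_eq
  have h1 : χ.centralChar (Function.extend ι (sigmaChar X) 0) =
      (χ 1)⁻¹ * ∑ a, sigmaChar X a * χ (ι a)⁻¹ := by
    rw [Irr.centralChar_apply]
    congr 1
    symm
    refine Fintype.sum_of_injective ι hι _ _ (fun g hg => ?_) fun a => ?_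
    · rw [Function.extend_apply' _ _ _ fun ⟨a, ha⟩ => hg ⟨a, ha⟩, Pi.zero_apply, zero_mul]
    · rw [hι.extend_apply]
  have h2 : ∀ ψ : Irr A, ∑ a, ψ a * χ (ι a)⁻¹ = Nat.card A * m ψ := by
    intro ψ
    rw [← hm ψ, characterInner, mul_inv_cancel_left₀ hA, finsum_eq_sum_of_fintype]
    refine Fintype.sum_equiv (Equiv.inv A) _ _ fun a => ?_
    simp [mul_comm]
  have h3 : ∑ a, sigmaChar X a * χ (ι a)⁻¹ =
      Nat.card A * ((∑ ψ, if ψ ∈ X then d ψ * m ψ else 0 : ℕ) : ℂ) := by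
    simp only [sigmaChar, finsum_eq_if]
    simp only [finsum_eq_sum_of_fintype, Finset.sum_mul]
    rw [Finset.sum_comm]
    push_cast
    rw [Finset.mul_sum]
    refine Finset.sum_congr rfl fun ψ _ => ?_
    split_ifs
    · rw [mul_left_comm, ← h2, hd, Finset.mul_sum]
      exact Finset.sum_congr rfl fun a _ => by ring
    · simp
  rw [h1, h3, mul_ne_zero_iff, mul_ne_zero_iff]
  have h4 : (χ 1)⁻¹ ≠ 0 := inv_ne_zero χ.one_ne_zero
  simp only [ne_eq, h4, not_false_eq_true, hA, true_and, Nat.cast_eq_zero, Finset.sum_eq_zero_iff,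
    Finset.mem_univ, forall_const, charsAbove, Set.mem_ofPred_eq, hm]
  push Not
  refine exists_congr fun ψ => ?_
  have := hd0 ψ
  split_ifs with h <;> simp [h, this]

end Extend

theorem convolution_comp_surjective {G Q : Type*} [Group G] [Finite G] [Group Q] (π : G →* Q)
    (hπ : Function.Surjective π) (f h : Q → ℂ) :
    convolution (f ∘ π) (h ∘ π) = (Nat.card π.ker : ℂ) • (convolution f h ∘ π) := by
  classical
  have := Finite.of_surjective π hπ
  have := Fintype.ofFinite G
  have := Fintype.ofFinite Q
  ext x
  simp only [convolution, finsum_eq_sum_of_fintype, Function.comp_apply, Pi.smul_apply,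
    smul_eq_mul, map_mul, map_inv]
  rw [← Finset.sum_fiberwise Finset.univ π, Finset.mul_sum]
  refine Finset.sum_congr rfl fun q _ => ?_
  have h1 : ∀ y ∈ Finset.univ.filter (fun y => π y = q), f (π y) * h ((π y)⁻¹ * π x) =
      f q * h (q⁻¹ * π x) := by
    intro y hy
    rw [(Finset.mem_filter.1 hy).2]
  rw [Finset.sum_congr rfl h1, Finset.sum_const, nsmul_eq_mul]
  congr 2
  rw [MonoidHom.card_fiber_eq_of_mem_range π (hπ q) (hπ 1), ← Fintype.card_subtype,
    ← Nat.card_eq_fintype_card]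
  rfl

/-! ### Restriction, deflation and the `*`-product -/

/-- Every member of `𝒦` is contained in `N` or is a union of cosets of `N`. For the superclasses of
a supercharacter theory this says that it is a `*`-product over `N`. -/
def FactorsClasses {G : Type*} [Group G] (𝒦 : Set (Set G)) (N : Subgroup G) : Prop :=
  ∀ K ∈ 𝒦, K ⊆ N ∨ ∀ x ∈ K, ∀ n ∈ N, x * n ∈ K

/-- A set that is a union of cosets of the kernel is the preimage of its image. -/
theorem preimage_image_of_mul_ker_mem {G Q : Type*} [Group G] [Group Q] {π : G →* Q} {K : Set G}
    (h : ∀ x ∈ K, ∀ n ∈ π.ker, x * n ∈ K) : π ⁻¹' (π '' K) = K := by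
  refine Set.Subset.antisymm ?_ (Set.subset_preimage_image _ _)
  rintro y ⟨x, hx, e⟩
  have := h x hx (x⁻¹ * y) (by rw [MonoidHom.mem_ker, map_mul, map_inv, e, inv_mul_cancel])
  rwa [mul_inv_cancel_left] at this

namespace SupercharacterTheory

section Basic

variable {G : Type*} [Group G]

theorem one_mem_iff (C : SupercharacterTheory G) {K : Set G} (hK : K ∈ C.classes) :
    (1 : G) ∈ K ↔ K = {1} :=
  ⟨fun h => C.classes_isPartition.eq_of_mem hK C.one_mem h rfl, fun h => h ▸ rfl⟩

theorem subset_or_disjoint (C : SupercharacterTheory G) {N : Subgroup G}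
    (h : FactorsClasses C.classes N) : ∀ K ∈ C.classes, K ⊆ N ∨ Disjoint K N := by
  intro K hK
  by_cases h1 : K = {1}
  · left
    rw [h1, Set.singleton_subset_iff]
    exact N.one_mem
  refine (h K hK).imp_right fun hKN => Set.disjoint_left.2 fun x hx hxN => h1 ?_
  rw [← C.one_mem_iff hK]
  simpa using hKN x hx x⁻¹ (N.inv_mem hxN)

/-- Of two subgroups over which the superclasses factor, one contains the other: if `x ∈ M` is not
in `N`, then the superclass of `x` lies in `M` and contains `xN`. -/
theorem le_or_le_of_factorsClasses (C : SupercharacterTheory G) {M N : Subgroup G}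
    (hM : FactorsClasses C.classes M) (hN : FactorsClasses C.classes N) : M ≤ N ∨ N ≤ M := by
  by_contra! hcon
  obtain ⟨x, hxM, hxN⟩ := SetLike.not_le_iff_exists.1 hcon.1
  obtain ⟨K, hK, hxK⟩ := C.classes_isPartition.exists_mem x
  have h1 : K ⊆ M := (C.subset_or_disjoint hM K hK).resolve_right
    fun h => Set.disjoint_left.1 h hxK hxM
  refine hcon.2 fun n hn => ?_
  have h2 := h1 ((hN K hK).resolve_left (fun h => hxN (h hxK)) x hxK n hn)
  exact (M.mul_mem_cancel_left hxM).1 h2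

end Basic

variable {A G Q : Type*} [Group A] [Group G] [Group Q]

theorem extend_mem_constOn {C : SupercharacterTheory G} {ι : A →* G} (hι : Function.Injective ι)
    (h : ∀ K ∈ C.classes, K ⊆ ι.range ∨ Disjoint K (ι.range : Set G)) {f : A → ℂ}
    (hf : f ∈ constOn {K | ι '' K ∈ C.classes}) : Function.extend ι f 0 ∈ constOn C.classes := by
  intro K hK x hx y hy
  rcases h K hK with hs | hd
  · obtain ⟨a, rfl⟩ := hs hx
    obtain ⟨b, rfl⟩ := hs hy
    rw [hι.extend_apply, hι.extend_apply]
    exact hf (ι ⁻¹' K) (by rwa [Set.mem_ofPred_eq, Set.image_preimage_eq_of_subset hs]) a hx b hy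
  · have h0 : ∀ z ∈ K, Function.extend ι f 0 z = 0 := fun z hz =>
      Function.extend_apply' _ _ _ fun ⟨a, ha⟩ => Set.disjoint_left.1 hd hz ⟨a, ha⟩
    rw [h0 x hx, h0 y hy]

theorem comp_mem_constOn {C : SupercharacterTheory G} {π : G →* Q}
    (h : FactorsClasses C.classes π.ker) {f : Q → ℂ}
    (hf : f ∈ constOn {L | L = {1} ∨ π ⁻¹' L ∈ C.classes}) : f ∘ π ∈ constOn C.classes := by
  intro K hK x hx y hy
  rcases h K hK with hs | hc
  · simp only [Function.comp_apply, MonoidHom.mem_ker.1 (hs hx), MonoidHom.mem_ker.1 (hs hy)]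
  · refine hf (π '' K) (Or.inr ?_) _ (Set.mem_image_of_mem π hx) _ (Set.mem_image_of_mem π hy)
    rwa [preimage_image_of_mul_ker_mem hc]

variable [Finite G]

/-- A supercharacter theory restricts to every subgroup that is a union of superclasses. -/
theorem exists_restrict [Finite A] (C : SupercharacterTheory G) {ι : A →* G}
    (hι : Function.Injective ι)
    (h : ∀ K ∈ C.classes, K ⊆ ι.range ∨ Disjoint K (ι.range : Set G)) :
    ∃ B : SupercharacterTheory A, B.classes = {K | ι '' K ∈ C.classes} := by
  have hcomp : ∀ f : A → ℂ, Function.extend ι f 0 ∈ constOn C.classes →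
      f ∈ constOn {K | ι '' K ∈ C.classes} := by
    intro f hf K hK x hx y hy
    have := hf _ hK _ (Set.mem_image_of_mem ι hx) _ (Set.mem_image_of_mem ι hy)
    rwa [hι.extend_apply, hι.extend_apply] at this
  refine exists_of_convolution_mem (Setoid.IsPartition.of_forall ?_ ?_ ?_) ?_ ?_ ?_
  · intro K hK
    exact Set.image_nonempty.1 (C.classes_isPartition.nonempty hK)
  · intro a
    obtain ⟨K, hK, ha⟩ := C.classes_isPartition.exists_mem (ι a)
    have hs : K ⊆ Set.range ι := (h K hK).resolve_right
      fun hd => Set.disjoint_left.1 hd ha ⟨a, rfl⟩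
    exact ⟨ι ⁻¹' K, by rwa [Set.mem_ofPred_eq, Set.image_preimage_eq_of_subset hs], ha⟩
  · intro K hK L hL a ha ha'
    exact hι.image_injective (C.classes_isPartition.eq_of_mem hK hL
      (Set.mem_image_of_mem ι ha) (Set.mem_image_of_mem ι ha'))
  · rw [Set.mem_ofPred_eq, Set.image_singleton, map_one]
    exact C.one_mem
  · intro f hf g x
    have := C.isClassFunction (extend_mem_constOn hι h hf) (ι g) (ι x)
    rwa [← map_inv, ← map_mul, ← map_mul, hι.extend_apply, hι.extend_apply] at this
  · intro f hf k hk
    refine hcomp _ ?_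
    rw [← convolution_extend hι]
    exact C.convolution_mem (extend_mem_constOn hι h hf) (extend_mem_constOn hι h hk)

/-- A supercharacter theory that factors over the kernel of a surjective homomorphism induces one
on the quotient. -/
theorem exists_deflate (C : SupercharacterTheory G) {π : G →* Q}
    (hπ : Function.Surjective π) (h : FactorsClasses C.classes π.ker) :
    ∃ D : SupercharacterTheory Q, D.classes = {L | L = {1} ∨ π ⁻¹' L ∈ C.classes} := by
  have := Finite.of_surjective π hπ
  have hcomp : ∀ f, f ∘ π ∈ constOn C.classes →
      f ∈ constOn {L | L = {1} ∨ π ⁻¹' L ∈ C.classes} := by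
    rintro f hf L (rfl | hL) x hx y hy
    · rw [Set.mem_singleton_iff.1 hx, Set.mem_singleton_iff.1 hy]
    · obtain ⟨a, rfl⟩ := hπ x
      obtain ⟨b, rfl⟩ := hπ y
      exact hf _ hL a hx b hy
  have hne : ∀ L, π ⁻¹' L ∈ C.classes → (1 : Q) ∈ L → L = {1} := by
    intro L hL h1
    have h2 : π ⁻¹' L = {1} := (C.one_mem_iff hL).1 (by rwa [Set.mem_preimage, map_one])
    rw [← Set.image_preimage_eq L hπ, h2, Set.image_singleton, map_one]
  refine exists_of_convolution_mem (Setoid.IsPartition.of_forall ?_ ?_ ?_) (Or.inl rfl) ?_ ?_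
  · rintro L (rfl | hL)
    · exact Set.singleton_nonempty 1
    · rw [← Set.image_preimage_eq L hπ]
      exact (C.classes_isPartition.nonempty hL).image π
  · intro q
    obtain ⟨x, rfl⟩ := hπ q
    obtain ⟨K, hK, hx⟩ := C.classes_isPartition.exists_mem x
    rcases h K hK with hs | hc
    · exact ⟨{1}, Or.inl rfl, MonoidHom.mem_ker.1 (hs hx)⟩
    · refine ⟨π '' K, Or.inr ?_, Set.mem_image_of_mem π hx⟩
      rwa [preimage_image_of_mul_ker_mem hc]
  · rintro K (rfl | hK) L (rfl | hL) q hq hq'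
    · rfl
    · rw [Set.mem_singleton_iff.1 hq] at hq'
      exact (hne L hL hq').symm
    · rw [Set.mem_singleton_iff.1 hq'] at hq
      exact hne K hK hq
    · obtain ⟨x, rfl⟩ := hπ q
      exact hπ.preimage_injective (C.classes_isPartition.eq_of_mem hK hL hq hq')
  · intro f hf q r
    obtain ⟨x, rfl⟩ := hπ q
    obtain ⟨y, rfl⟩ := hπ r
    have := C.isClassFunction (comp_mem_constOn h hf) x y
    simpa using this
  · intro f hf k hk
    refine hcomp _ ?_
    have h1 := C.convolution_mem (comp_mem_constOn h hf) (comp_mem_constOn h hk)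
    rw [convolution_comp_surjective π hπ] at h1
    have h2 : (Nat.card π.ker : ℂ) ≠ 0 := by exact_mod_cast Nat.card_pos.ne'
    exact (Submodule.smul_mem_iff _ h2).1 h1

theorem trivialChars_mem (C : SupercharacterTheory G) : trivialChars G ∈ C.chars := by
  classical
  have h1 : (Irr.triv G).1 ∈ constOn C.classes := fun _ _ _ _ _ _ => rfl
  have h2 := (C.mem_constOn_classes_iff.1 h1).2
  obtain ⟨X, hX, ht⟩ := C.chars_isPartition.exists_mem (Irr.triv G)
  have hG : (Nat.card G : ℂ) ≠ 0 := by exact_mod_cast Nat.card_pos.ne'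
  have h3 : X = {Irr.triv G} := by
    refine Set.Subset.antisymm (fun χ hχ => ?_) (Set.singleton_subset_iff.2 ht)
    have h4 := h2 X hX χ hχ _ ht
    by_contra hne
    replace hne : χ ≠ Irr.triv G := hne
    simp [Irr.centralChar_irr, hne, Irr.triv_apply] at h4
    exact hG h4.symm
  rw [Irr.trivialChars_eq, ← h3]
  exact hX

/-- A supercharacter theory whose superclasses factor over a normal subgroup is the `*`-product of
its restriction and its deflation. For the superclasses this is immediate. The sets of characters
of the `*`-product are pairwise disjoint unions of parts of `C.chars`, as central characters show,
and there are as many of them as there are parts. -/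
theorem toPartPair_eq_star [Finite A] (C : SupercharacterTheory G) {ι : A →* G} {π : G →* Q}
    (hι : Function.Injective ι) (hπ : Function.Surjective π) (hex : ι.range = π.ker)
    (h : FactorsClasses C.classes π.ker) (B : SupercharacterTheory A)
    (hB : B.classes = {K | ι '' K ∈ C.classes}) (D : SupercharacterTheory Q)
    (hD : D.classes = {L | L = {1} ∨ π ⁻¹' L ∈ C.classes}) :
    C.toPartPair = PartPair.star ι π B.toPartPair D.toPartPair := by
  classical
  have := Finite.of_surjective π hπ
  have hA : (Nat.card A : ℂ) ≠ 0 := by exact_mod_cast Nat.card_pos.ne'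
  have hr : ∀ K ∈ C.classes, K ⊆ ι.range ∨ Disjoint K (ι.range : Set G) := by
    rw [hex]
    exact C.subset_or_disjoint h
  have hιπ : ∀ a, π (ι a) = 1 := fun a => by
    rw [← MonoidHom.mem_ker, ← hex]
    exact ⟨a, rfl⟩
  have hcl : C.classes = (PartPair.star ι π B.toPartPair D.toPartPair).classes := by
    ext K
    simp only [PartPair.star, hB, hD]
    constructor
    · intro hK
      by_cases hs : K ⊆ ι.range
      · have e := Set.image_preimage_eq_of_subset hs
        exact Or.inl ⟨ι ⁻¹' K, by rwa [Set.mem_ofPred_eq, e], e⟩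
      · have hs' : ¬ K ⊆ π.ker := by rwa [← hex]
        have e := preimage_image_of_mul_ker_mem ((h K hK).resolve_left hs')
        refine Or.inr ⟨π '' K, ⟨Or.inr (by rwa [e]), fun h1 => hs' fun x hx => ?_⟩, e⟩
        have : π x ∈ π '' K := ⟨x, hx, rfl⟩
        rw [h1] at this
        exact this
    · rintro (⟨K, hK, rfl⟩ | ⟨L, ⟨hL | hL, hL1⟩, rfl⟩)
      · exact hK
      · exact absurd hL hL1
      · exact hL
  -- A member of `B.chars` is detected by the extension of its character by zero.
  have hext : ∀ X ∈ B.chars, Function.extend ι (sigmaChar X) 0 ∈ constOn C.classes :=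
    fun X hX => extend_mem_constOn hι hr (hB ▸ B.sigma_const X hX)
  have hinfl : ∀ Y ∈ D.chars, sigmaChar (inflateChars π Y) ∈ constOn C.classes := by
    intro Y hY
    rw [Irr.sigmaChar_inflateChars π hπ]
    exact comp_mem_constOn h (hD ▸ D.sigma_const Y hY)
  have habove : ∀ X ∈ B.chars, (charsAbove ι X).Nonempty := by
    intro X hX
    by_contra hcon
    have h0 : Function.extend ι (sigmaChar X) 0 = 0 := by
      refine Irr.eq_zero_of_centralChar (C.isClassFunction (hext X hX)) fun χ => ?_
      by_contra hne
      exact hcon ⟨χ, (centralChar_extend_sigmaChar_ne_zero_iff hι X χ).1 hne⟩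
    have h1 : sigmaChar X = 0 := by
      ext a
      have := congrFun h0 (ι a)
      rwa [hι.extend_apply] at this
    obtain ⟨ψ, hψ⟩ := B.chars_isPartition.nonempty hX
    have h2 := ψ.centralChar_sigmaChar X
    rw [h1, map_zero, if_pos hψ] at h2
    exact hA h2.symm
  have haa : ∀ X ∈ B.chars, ∀ X' ∈ B.chars, ∀ χ ∈ charsAbove ι X, χ ∈ charsAbove ι X' →
      X = X' := by
    intro X hX X' hX' χ hχ hχ'
    by_contra hne
    -- Distinct `σ_X` and `σ_X'` convolve to zero, and so do their extensions by zero.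
    have h1 : convolution (sigmaChar X) (sigmaChar X') = 0 := by
      refine Irr.eq_zero_of_centralChar ((Irr.isClassFunction_sigmaChar X).convolution
        (Irr.isClassFunction_sigmaChar X')) fun ψ => ?_
      rw [ψ.centralChar_convolution (Irr.isClassFunction_sigmaChar X)
        (Irr.isClassFunction_sigmaChar X') ((Irr.isClassFunction_sigmaChar X).convolution
        (Irr.isClassFunction_sigmaChar X')), ψ.centralChar_sigmaChar, ψ.centralChar_sigmaChar]
      by_cases hψ : ψ ∈ X
      · rw [if_neg (fun hψ' => hne (B.chars_isPartition.eq_of_mem hX hX' hψ hψ')), mul_zero]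
      · rw [if_neg hψ, zero_mul]
    have h2 := convolution_extend hι (sigmaChar X) (sigmaChar X')
    have h3 : Function.extend ι (0 : A → ℂ) (0 : G → ℂ) = 0 := by
      ext g
      by_cases hg : ∃ a, ι a = g
      · obtain ⟨a, rfl⟩ := hg
        rw [hι.extend_apply]; rfl
      · rw [Function.extend_apply' _ _ _ hg]
    have c1 := C.isClassFunction (hext X hX)
    have c2 := C.isClassFunction (hext X' hX')
    have h4 := χ.centralChar_convolution c1 c2 (c1.convolution c2)
    rw [h2, h1, h3, map_zero] at h4
    exact mul_ne_zero ((centralChar_extend_sigmaChar_ne_zero_iff hι X χ).2 hχ)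
      ((centralChar_extend_sigmaChar_ne_zero_iff hι X' χ).2 hχ') h4.symm
  have hii : ∀ Y ∈ D.chars, ∀ Y' ∈ D.chars, ∀ χ ∈ inflateChars π Y, χ ∈ inflateChars π Y' →
      Y = Y' := by
    intro Y hY Y' hY' χ hχ hχ'
    rw [Irr.inflateChars_eq_image π hπ] at hχ hχ'
    obtain ⟨ψ, hψ, rfl⟩ := hχ
    obtain ⟨φ, hφ, e⟩ := hχ'
    rw [Irr.inflate_injective π hπ e] at hφ
    exact D.chars_isPartition.eq_of_mem hY hY' hψ hφ
  have hia : ∀ (Y : Set (Irr Q)), ∀ X ∈ B.chars, ∀ χ ∈ inflateChars π Y, χ ∈ charsAbove ι X →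
      X = trivialChars A := by
    rintro Y X hX χ ⟨ψ, hψ, e⟩ ⟨φ, hφ, hne⟩
    -- The restriction of an inflated character is a multiple of the trivial character.
    have h1 : characterInner (fun a => χ (ι a)) φ.1 =
        ψ 1 * characterInner (Irr.triv A).1 φ.1 := by
      have := Fintype.ofFinite A
      simp only [characterInner, finsum_eq_sum_of_fintype, e, hιπ, Irr.triv_apply, one_mul,
        Finset.mul_sum]
      exact Finset.sum_congr rfl fun a _ => by ring
    have h2 : Irr.triv A = φ := by
      by_contra h3
      rw [h1, (characterInner_irr _ _).2 h3, mul_zero] at hne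
      exact hne rfl
    refine B.chars_isPartition.eq_of_mem hX B.trivialChars_mem hφ ?_
    rw [← h2, Irr.trivialChars_eq]
    rfl
  have hni : ∀ Y ∈ D.chars, (inflateChars π Y).Nonempty := by
    intro Y hY
    rw [Irr.inflateChars_eq_image π hπ]
    exact (D.chars_isPartition.nonempty hY).image _
  have hch : C.chars = (PartPair.star ι π B.toPartPair D.toPartPair).chars := by
    refine C.chars_eq_of_ncard_le ?_ ?_ ?_ ?_
    · rintro Z (⟨Y, hY, rfl⟩ | ⟨X, hX, rfl⟩)
      · exact hni Y hY
      · exact habove X hX.1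
    · rintro Z (⟨Y, hY, rfl⟩ | ⟨X, hX, rfl⟩) Z' (⟨Y', hY', rfl⟩ | ⟨X', hX', rfl⟩) χ hχ hχ'
      · rw [hii Y hY Y' hY' χ hχ hχ']
      · exact absurd (hia Y X' hX'.1 χ hχ hχ') hX'.2
      · exact absurd (hia Y' X hX.1 χ hχ' hχ) hX.2
      · rw [haa X hX.1 X' hX'.1 χ hχ hχ']
    · rintro Z (⟨Y, hY, rfl⟩ | ⟨X, hX, rfl⟩)
      · exact ⟨_, hinfl Y hY, Irr.centralChar_sigmaChar_ne_zero_iff _⟩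
      · exact ⟨_, hext X hX.1, centralChar_extend_sigmaChar_ne_zero_iff hι X⟩
    · have hd : Disjoint (inflateChars π '' D.chars)
          (charsAbove ι '' (B.chars \ {trivialChars A})) := by
        rw [Set.disjoint_left]
        rintro Z ⟨Y, hY, rfl⟩ ⟨X, hX, e⟩
        obtain ⟨χ, hχ⟩ := hni Y hY
        exact hX.2 (hia Y X hX.1 χ hχ (e ▸ hχ))
      have hi1 : Set.InjOn (inflateChars π) D.chars := by
        intro Y hY Y' hY' e
        obtain ⟨χ, hχ⟩ := hni Y hY
        exact hii Y hY Y' hY' χ hχ (e ▸ hχ)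
      have hi2 : Set.InjOn (charsAbove ι) (B.chars \ {trivialChars A}) := by
        intro X hX X' hX' e
        obtain ⟨χ, hχ⟩ := habove X hX.1
        exact haa X hX.1 X' hX'.1 χ hχ (e ▸ hχ)
      have h1 : (PartPair.star ι π B.toPartPair D.toPartPair).chars.ncard =
          D.chars.ncard + (B.chars.ncard - 1) := by
        simp only [PartPair.star]
        rw [Set.ncard_union_eq hd (Set.toFinite _) (Set.toFinite _), hi1.ncard_image,
          hi2.ncard_image, Set.ncard_sdiff_singleton_of_mem B.trivialChars_mem]
      have h2 : C.classes.ncard ≤ B.classes.ncard + (D.classes.ncard - 1) := by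
        rw [hcl]
        simp only [PartPair.star]
        refine (Set.ncard_union_le _ _).trans (add_le_add (Set.ncard_image_le (Set.toFinite _)) ?_)
        rw [← Set.ncard_sdiff_singleton_of_mem D.one_mem]
        exact Set.ncard_image_le (Set.toFinite _)
      have h3 : 0 < B.chars.ncard := (Set.ncard_pos (Set.toFinite _)).2 ⟨_, B.trivialChars_mem⟩
      have h4 : 0 < D.chars.ncard := (Set.ncard_pos (Set.toFinite _)).2 ⟨_, D.trivialChars_mem⟩
      rw [h1]
      rw [← B.ncard_eq, ← D.ncard_eq] at h2
      omega
  exact PartPair.ext hch hcl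

end SupercharacterTheory

/-! ### Sections between two factors -/

/-- The preimage in `G` of a subset of the section `M / N`. -/
def sectionPreimage {G : Type*} [Group G] (N M : Subgroup G) [N.Normal]
    (L : Set (M ⧸ N.subgroupOf M)) : Set G :=
  M.subtype '' (QuotientGroup.mk' (N.subgroupOf M) ⁻¹' L)

section SectionPreimage

variable {G : Type*} [Group G] {N M : Subgroup G} [N.Normal]

theorem mem_sectionPreimage {L : Set (M ⧸ N.subgroupOf M)} {g : G} :
    g ∈ sectionPreimage N M L ↔ ∃ h : g ∈ M, QuotientGroup.mk' (N.subgroupOf M) ⟨g, h⟩ ∈ L := by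
  constructor
  · rintro ⟨x, hx, rfl⟩
    exact ⟨x.2, hx⟩
  · rintro ⟨h, hL⟩
    exact ⟨⟨g, h⟩, hL, rfl⟩

theorem coe_mem_sectionPreimage {L : Set (M ⧸ N.subgroupOf M)} {x : M} :
    (x : G) ∈ sectionPreimage N M L ↔ QuotientGroup.mk' (N.subgroupOf M) x ∈ L :=
  mem_sectionPreimage.trans ⟨fun ⟨_, h⟩ => h, fun h => ⟨x.2, h⟩⟩

theorem sectionPreimage_subset (L : Set (M ⧸ N.subgroupOf M)) : sectionPreimage N M L ⊆ M := by
  rintro _ ⟨x, -, rfl⟩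
  exact x.2

theorem sectionPreimage_injective : Function.Injective (sectionPreimage N M) :=
  (Set.image_injective.2 M.subtype_injective).comp
    (QuotientGroup.mk'_surjective _).preimage_injective

theorem mul_mem_sectionPreimage (hNM : N ≤ M) {L : Set (M ⧸ N.subgroupOf M)} {x n : G}
    (hx : x ∈ sectionPreimage N M L) (hn : n ∈ N) : x * n ∈ sectionPreimage N M L := by
  obtain ⟨h, hL⟩ := mem_sectionPreimage.1 hx
  refine mem_sectionPreimage.2 ⟨M.mul_mem h (hNM hn), ?_⟩
  have : QuotientGroup.mk' (N.subgroupOf M) ⟨x * n, M.mul_mem h (hNM hn)⟩ =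
      QuotientGroup.mk' (N.subgroupOf M) ⟨x, h⟩ := by
    rw [QuotientGroup.mk'_apply, QuotientGroup.mk'_apply, QuotientGroup.eq,
      Subgroup.mem_subgroupOf]
    simpa using hn
  rwa [this]

end SectionPreimage

namespace SupercharacterTheory

theorem factorsClasses_of_factorsOver {G : Type*} [Group G] {C : SupercharacterTheory G}
    {N : Subgroup G} [N.Normal] (h : C.FactorsOver N) : FactorsClasses C.classes N := by
  obtain ⟨B, D, -, e⟩ := h
  intro K hK
  rw [e] at hK
  rcases hK with ⟨K, hK, rfl⟩ | ⟨L, hL, rfl⟩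
  · left
    rintro _ ⟨x, -, rfl⟩
    exact x.2
  · right
    intro x hx n hn
    have h1 : QuotientGroup.mk' N n = 1 := (QuotientGroup.eq_one_iff n).2 hn
    rw [Set.mem_preimage, map_mul, h1, mul_one]
    exact hx

variable {G : Type*} [Group G] [Finite G]

/-- Whether a supercharacter theory is a `*`-product over `N` can be read off from its
superclasses. -/
theorem factorsOver_of_factorsClasses (C : SupercharacterTheory G) {N : Subgroup G} [N.Normal]
    (h : FactorsClasses C.classes N) : C.FactorsOver N := by
  have hk : (QuotientGroup.mk' N).ker = N := QuotientGroup.ker_mk' N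
  have h' : FactorsClasses C.classes (QuotientGroup.mk' N).ker := by rwa [hk]
  have hr : N.subtype.range = (QuotientGroup.mk' N).ker := by rw [hk, N.range_subtype]
  obtain ⟨B, hB⟩ := C.exists_restrict N.subtype_injective
    (by rw [N.range_subtype]; exact C.subset_or_disjoint h)
  obtain ⟨D, hD⟩ := C.exists_deflate (QuotientGroup.mk'_surjective N) h'
  refine ⟨B, D, fun g K hK => ?_, C.toPartPair_eq_star N.subtype_injective
    (QuotientGroup.mk'_surjective N) hr h' B hB D hD⟩
  rw [hB] at hK
  have hsub : ∀ g : G, ∀ x ∈ K, MulAut.conjNormal g x ∈ K := by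
    intro g x hx
    obtain ⟨y, hy, e⟩ := C.conj_mem hK (Set.mem_image_of_mem _ hx) g
    have : MulAut.conjNormal g x = y := Subtype.ext (by
      rw [MulAut.conjNormal_apply]
      exact e.symm)
    rwa [this]
  refine Set.Subset.antisymm ?_ fun x hx => ⟨MulAut.conjNormal g⁻¹ x, hsub g⁻¹ x hx, ?_⟩
  · rintro _ ⟨x, hx, rfl⟩
    exact hsub g x hx
  · rw [map_inv]
    exact MulAut.apply_inv_self _ _ _

/-- A normal subgroup strictly inside a section over which the superclasses factor decomposes the
supercharacter theory of the section. -/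
theorem decomposable_of_lt_of_lt {N M K : Subgroup G} [N.Normal] [K.Normal] {𝒦 : Set (Set G)}
    (D : SupercharacterTheory (M ⧸ N.subgroupOf M))
    (hD : ∀ L ∈ D.classes, L ≠ {1} → sectionPreimage N M L ∈ 𝒦) (hK : FactorsClasses 𝒦 K)
    (hNK : N < K) (hKM : K < M) : D.Decomposable := by
  let π := QuotientGroup.mk' (N.subgroupOf M)
  have hπ : Function.Surjective π := QuotientGroup.mk'_surjective _
  have hker : ∀ x : M, π x = 1 ↔ (x : G) ∈ N := fun x => by
    rw [← MonoidHom.mem_ker, QuotientGroup.ker_mk', Subgroup.mem_subgroupOf]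
  have hnorm : ((K.subgroupOf M).map π).Normal := Subgroup.Normal.map inferInstance π hπ
  refine ⟨(K.subgroupOf M).map π, hnorm, fun hbot => ?_, fun htop => ?_,
    D.factorsOver_of_factorsClasses fun L hL => ?_⟩
  · refine hNK.not_ge fun x hx => (hker ⟨x, hKM.le hx⟩).1 ?_
    have : π ⟨x, hKM.le hx⟩ ∈ (K.subgroupOf M).map π :=
      Subgroup.mem_map_of_mem _ (Subgroup.mem_subgroupOf.2 hx)
    rwa [hbot, Subgroup.mem_bot] at this
  · refine hKM.not_ge fun x hx => ?_
    have : π ⟨x, hx⟩ ∈ (K.subgroupOf M).map π := by rw [htop]; trivial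
    obtain ⟨y, hy, e⟩ := Subgroup.mem_map.1 this
    have h1 : π (y⁻¹ * ⟨x, hx⟩) = 1 := by rw [map_mul, map_inv, e, inv_mul_cancel]
    have h2 := hNK.le ((hker _).1 h1)
    exact (K.mul_mem_cancel_left (K.inv_mem (Subgroup.mem_subgroupOf.1 hy))).1 h2
  · by_cases h1 : L = {1}
    · left
      rw [h1, Set.singleton_subset_iff]
      exact Subgroup.one_mem _
    · refine (hK _ (hD L hL h1)).imp (fun hs q hq => ?_) fun hc q hq n hn => ?_
      · obtain ⟨x, rfl⟩ := hπ q
        exact Subgroup.mem_map_of_mem _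
          (Subgroup.mem_subgroupOf.2 (hs (coe_mem_sectionPreimage.2 hq)))
      · obtain ⟨x, rfl⟩ := hπ q
        obtain ⟨y, hy, rfl⟩ := Subgroup.mem_map.1 hn
        have := hc x (coe_mem_sectionPreimage.2 hq) y (Subgroup.mem_subgroupOf.1 hy)
        rw [← map_mul]
        exact coe_mem_sectionPreimage.1 (by simpa using this)

/-- The supercharacter theory induced on a section `M / N` between two factors. -/
theorem exists_section (C : SupercharacterTheory G) {N M : Subgroup G} [N.Normal] (hNM : N ≤ M)
    (hN : FactorsClasses C.classes N) (R : SupercharacterTheory M)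
    (hR : R.classes = {K | M.subtype '' K ∈ C.classes}) (S : SupercharacterTheory N)
    (hS : S.classes = {K | N.subtype '' K ∈ C.classes}) :
    ∃ D : SupercharacterTheory (M ⧸ N.subgroupOf M),
      D.classes = {L | L = {1} ∨ sectionPreimage N M L ∈ C.classes} ∧
      R.toPartPair = PartPair.star (Subgroup.inclusion hNM)
        (QuotientGroup.mk' (N.subgroupOf M)) S.toPartPair D.toPartPair := by
  have hfac : FactorsClasses R.classes (QuotientGroup.mk' (N.subgroupOf M)).ker := by
    rw [QuotientGroup.ker_mk', hR]
    refine fun K hK => (hN _ hK).imp (fun hs x hx => ?_) fun hc x hx n hn => ?_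
    · exact Subgroup.mem_subgroupOf.2 (hs ⟨x, hx, rfl⟩)
    · obtain ⟨y, hy, e⟩ := hc x ⟨x, hx, rfl⟩ n (Subgroup.mem_subgroupOf.1 hn)
      have : x * n = y := Subtype.ext e.symm
      rwa [this]
  obtain ⟨D, hD⟩ := R.exists_deflate (QuotientGroup.mk'_surjective _) hfac
  refine ⟨D, by rw [hD, hR]; rfl, R.toPartPair_eq_star (Subgroup.inclusion_injective hNM)
    (QuotientGroup.mk'_surjective _) ?_ hfac S ?_ D hD⟩
  · rw [QuotientGroup.ker_mk', Subgroup.inclusion_range]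
  · rw [hS, hR]
    ext K
    simp only [Set.mem_ofPred_eq, ← Set.image_comp]
    rfl

/-- The theory induced on a section is invariant under conjugation. -/
theorem isInvariant_section (C : SupercharacterTheory G) {N M : Subgroup G} [N.Normal] [M.Normal]
    (D : SupercharacterTheory (M ⧸ N.subgroupOf M))
    (hD : D.classes = {L | L = {1} ∨ sectionPreimage N M L ∈ C.classes}) :
    D.IsInvariant (conjQuotient N M) := by
  intro g L hL
  rw [hD] at hL
  rcases hL with rfl | hL
  · rw [Set.image_singleton, map_one]
  have hsub : ∀ g : G, ∀ q ∈ L, conjQuotient N M g q ∈ L := by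
    intro g q hq
    obtain ⟨x, rfl⟩ := QuotientGroup.mk'_surjective _ q
    have h1 := C.conj_mem hL (coe_mem_sectionPreimage.2 hq) g
    have h2 : conjQuotient N M g (QuotientGroup.mk' (N.subgroupOf M) x) =
        QuotientGroup.mk' (N.subgroupOf M) (MulAut.conjNormal g x) := rfl
    rw [h2, ← coe_mem_sectionPreimage, MulAut.conjNormal_apply]
    exact h1
  refine Set.Subset.antisymm ?_ fun x hx => ⟨conjQuotient N M g⁻¹ x, hsub g⁻¹ x hx, ?_⟩
  · rintro _ ⟨x, hx, rfl⟩
    exact hsub g x hx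
  · rw [map_inv]
    exact MulAut.apply_inv_self _ _ _

/-- If the theory induced on a section decomposes, then the superclasses factor over a normal
subgroup strictly inside the section. Invariance makes that subgroup normal in the whole group. -/
theorem exists_lt_lt_of_decomposable (C : SupercharacterTheory G) {N M : Subgroup G} [N.Normal]
    [M.Normal] (hNM : N ≤ M) (hN : FactorsClasses C.classes N) (hM : FactorsClasses C.classes M)
    (D : SupercharacterTheory (M ⧸ N.subgroupOf M))
    (hD : D.classes = {L | L = {1} ∨ sectionPreimage N M L ∈ C.classes}) (h : D.Decomposable) :
    ∃ K : Subgroup G, K.Normal ∧ FactorsClasses C.classes K ∧ N < K ∧ K < M := by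
  obtain ⟨J, hJ, hbot, htop, hfac⟩ := h
  replace hfac := factorsClasses_of_factorsOver hfac
  let π := QuotientGroup.mk' (N.subgroupOf M)
  have hπ : Function.Surjective π := QuotientGroup.mk'_surjective _
  have hker : ∀ x : M, π x = 1 ↔ (x : G) ∈ N := fun x => by
    rw [← MonoidHom.mem_ker, QuotientGroup.ker_mk', Subgroup.mem_subgroupOf]
  let K := (J.comap π).map M.subtype
  have hK : ∀ x : M, (x : G) ∈ K ↔ π x ∈ J := by
    intro x
    constructor
    · rintro ⟨y, hy, e⟩
      rwa [← Subtype.ext e]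
    · exact fun hx => ⟨x, hx, rfl⟩
  have hKM : K ≤ M := by
    rintro _ ⟨y, -, rfl⟩
    exact y.2
  have hNK : N ≤ K := fun n hn => by
    rw [hK ⟨n, hNM hn⟩, (hker _).2 hn]
    exact J.one_mem
  refine ⟨K, ⟨fun x hx g => ?_⟩, fun S hS => ?_, hNK.lt_of_ne ?_, hKM.lt_of_ne ?_⟩
  · obtain ⟨L, hL, hxL⟩ := D.classes_isPartition.exists_mem (π ⟨x, hKM hx⟩)
    have h1 : L ⊆ J := (D.subset_or_disjoint hfac L hL).resolve_right
      fun hd => Set.disjoint_left.1 hd hxL ((hK ⟨x, hKM hx⟩).1 hx)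
    have h2 : conjQuotient N M g (π ⟨x, hKM hx⟩) ∈ L := by
      rw [← C.isInvariant_section D hD g L hL]
      exact Set.mem_image_of_mem _ hxL
    exact (hK (MulAut.conjNormal g ⟨x, hKM hx⟩)).2 (h1 h2)
  · rcases hM S hS with hSM | hSM
    · rcases hN S hS with hSN | hSN
      · exact Or.inl (hSN.trans hNK)
      · let S' : Set M := M.subtype ⁻¹' S
        have hS' : ∀ x ∈ S', ∀ n ∈ π.ker, x * n ∈ S' := fun x hx n hn =>
          hSN x hx n ((hker n).1 hn)
        have e := preimage_image_of_mul_ker_mem hS'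
        have hL : π '' S' ∈ D.classes := by
          rw [hD]
          right
          have : sectionPreimage N M (π '' S') = S := by
            rw [sectionPreimage]
            exact (congrArg _ e).trans
              (Set.image_preimage_eq_of_subset (by rwa [M.coe_subtype, Subtype.range_coe]))
          rwa [this]
        refine (hfac _ hL).imp (fun hs x hx => ?_) fun hc x hx n hn => ?_
        · exact (hK ⟨x, hSM hx⟩).2 (hs ⟨⟨x, hSM hx⟩, hx, rfl⟩)
        · have h1 := hc (π ⟨x, hSM hx⟩) ⟨_, hx, rfl⟩ (π ⟨n, hKM hn⟩) ((hK ⟨n, hKM hn⟩).1 hn)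
          rw [← map_mul, ← Set.mem_preimage, e] at h1
          exact h1
    · exact Or.inr fun x hx n hn => hSM x hx n (hKM hn)
  · intro e
    refine hbot ((Subgroup.eq_bot_iff_forall _).2 fun q hq => ?_)
    obtain ⟨x, rfl⟩ := hπ q
    rw [hker, e, hK]
    exact hq
  · intro e
    refine htop ((Subgroup.eq_top_iff' _).2 fun q => ?_)
    obtain ⟨x, rfl⟩ := hπ q
    rw [← hK, e]
    exact x.2

/-- Transport of supercharacter theories along isomorphisms. -/
theorem toPartPair_eq_transport {H : Type*} [Group H] [Finite H] (C : SupercharacterTheory G)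
    (e : H ≃* G) (B : SupercharacterTheory H) (hB : B.classes = {K | e '' K ∈ C.classes}) :
    C.toPartPair = B.toPartPair.transport e := by
  have hs : Function.Surjective e.symm.toMonoidHom := e.symm.surjective
  have hcl : C.classes = (fun K : Set H => e '' K) '' B.classes := by
    ext K
    rw [hB]
    constructor
    · intro hK
      have h1 := Set.image_preimage_eq K e.surjective
      exact ⟨e ⁻¹' K, by rwa [Set.mem_ofPred_eq, h1], h1⟩
    · rintro ⟨K, hK, rfl⟩
      exact hK
  have hinj : Function.Injective (inflateChars e.symm.toMonoidHom) := by
    have : inflateChars e.symm.toMonoidHom = fun Y => Irr.inflate _ hs '' Y :=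
      funext fun Y => Irr.inflateChars_eq_image _ hs Y
    rw [this]
    exact Set.image_injective.2 (Irr.inflate_injective _ hs)
  refine PartPair.ext (C.chars_eq_of_ncard_le ?_ ?_ ?_ ?_) hcl
  · rintro _ ⟨Y, hY, rfl⟩
    rw [Irr.inflateChars_eq_image _ hs]
    exact (B.chars_isPartition.nonempty hY).image _
  · rintro _ ⟨Y, hY, rfl⟩ _ ⟨Y', hY', rfl⟩ χ hχ hχ'
    rw [Irr.inflateChars_eq_image _ hs] at hχ hχ'
    obtain ⟨ψ, hψ, rfl⟩ := hχ
    obtain ⟨φ, hφ, e⟩ := hχ'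
    rw [Irr.inflate_injective _ hs e] at hφ
    rw [B.chars_isPartition.eq_of_mem hY hY' hψ hφ]
  · rintro _ ⟨Y, hY, rfl⟩
    refine ⟨_, ?_, Irr.centralChar_sigmaChar_ne_zero_iff (inflateChars e.symm.toMonoidHom Y)⟩
    rw [Irr.sigmaChar_inflateChars _ hs, hcl]
    rintro _ ⟨K, hK, rfl⟩ _ ⟨x, hx, rfl⟩ _ ⟨y, hy, rfl⟩
    simpa using B.sigma_const Y hY K hK x hx y hy
  · rw [hcl]
    refine (Set.ncard_image_le (Set.toFinite _)).trans ?_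
    rw [PartPair.transport, Set.ncard_image_of_injective _ hinj, B.ncard_eq]

/-- The only supercharacter theory of the trivial group. -/
theorem toPartPair_eq_of_subsingleton [Subsingleton G] (C : SupercharacterTheory G) :
    C.toPartPair = ⟨{Set.univ}, {Set.univ}⟩ := by
  have huniv : ∀ {α : Type _} [Subsingleton α] [Nonempty α] (𝒮 : Set (Set α)),
      Setoid.IsPartition 𝒮 → 𝒮 = {Set.univ} := by
    intro α _ _ 𝒮 h
    refine h.eq_of_subset (Setoid.IsPartition.of_forall ?_ ?_ ?_) fun K hK => ?_
    · rintro _ rfl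
      exact Set.univ_nonempty
    · exact fun x => ⟨_, rfl, trivial⟩
    · rintro _ rfl _ rfl _ _ _
      rfl
    · obtain ⟨x, hx⟩ := h.nonempty hK
      exact Set.eq_univ_of_forall fun y => Subsingleton.elim x y ▸ hx
  have h1 : Subsingleton (Irr G) := by
    refine ⟨fun χ ψ => ?_⟩
    by_contra hne
    have h2 := (characterInner_irr χ ψ).2 hne
    have := Fintype.ofFinite G
    rw [characterInner, finsum_eq_sum_of_fintype, Fintype.sum_subsingleton _ (1 : G), inv_one] at h2
    exact mul_ne_zero (inv_ne_zero (by exact_mod_cast Nat.card_pos.ne'))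
      (mul_ne_zero χ.one_ne_zero ψ.one_ne_zero) h2
  have : Nonempty (Irr G) := ⟨Irr.triv G⟩
  exact PartPair.ext (huniv _ C.chars_isPartition) (huniv _ C.classes_isPartition)

end SupercharacterTheory

/-! ### Normal chains and their products -/

namespace NormalChain

variable {G : Type*} [Group G]

theorem strictMono (c : NormalChain G) : StrictMono c.N :=
  Fin.strictMono_iff_lt_succ.2 c.lt_succ

/-- A normal chain is determined by the set of its terms. -/
theorem ext_of_range {c c' : NormalChain G}
    (h : Set.range c.N = Set.range c'.N) : c = c' := by
  obtain ⟨r, N, hn, h0, hl, hlt⟩ := c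
  obtain ⟨r', N', hn', h0', hl', hlt'⟩ := c'
  have hN : StrictMono N := Fin.strictMono_iff_lt_succ.2 hlt
  have hN' : StrictMono N' := Fin.strictMono_iff_lt_succ.2 hlt'
  change Set.range N = Set.range N' at h
  have hr : r = r' := by
    have h1 := congrArg Set.ncard h
    rw [← Set.image_univ, ← Set.image_univ, Set.ncard_image_of_injective _ hN.injective,
      Set.ncard_image_of_injective _ hN'.injective, Set.ncard_univ, Set.ncard_univ] at h1
    simpa using h1
  subst hr
  have hNN : N = N' := (StrictMono.range_inj hN hN').1 h
  subst hNN
  rfl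

theorem mem_partialProduct_classes (c : NormalChain G)
    (D : ∀ i : Fin c.length, SupercharacterTheory (c.Factor i)) (k : Fin (c.length + 1))
    (S : Set G) :
    (∃ K ∈ (c.partialProduct D k).classes, (c.N k).subtype '' K = S) ↔
      S = {1} ∨ ∃ i : Fin c.length, i.castSucc < k ∧ ∃ L ∈ (D i).classes, L ≠ {1} ∧
        sectionPreimage (c.N i.castSucc) (c.N i.succ) L = S := by
  induction k using Fin.induction with
  | zero =>
    have h0 : (c.N 0).subtype '' Set.univ = {1} := by
      rw [Set.image_univ, c.N 0 |>.coe_subtype, Subtype.range_coe, c.zero_eq]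
      rfl
    have h1 : ∀ i : Fin c.length, ¬ i.castSucc < 0 := fun i => Fin.not_lt_zero _
    have h2 : (c.partialProduct D 0).classes = {Set.univ} := rfl
    simp only [h1, h2, false_and, exists_false, or_false, Set.mem_singleton_iff, exists_eq_left, h0]
    exact eq_comm
  | succ j ih =>
    have h1 : (c.partialProduct D j.succ) = PartPair.star
      (Subgroup.inclusion (c.lt_succ j).le)
      (QuotientGroup.mk' ((c.N j.castSucc).subgroupOf (c.N j.succ)))
      (c.partialProduct D j.castSucc) (D j).toPartPair := rfl
    have h2 : (∃ K ∈ (c.partialProduct D j.succ).classes, (c.N j.succ).subtype '' K = S) ↔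
        (∃ K ∈ (c.partialProduct D j.castSucc).classes, (c.N j.castSucc).subtype '' K = S) ∨
        ∃ L ∈ (D j).classes, L ≠ {1} ∧
          sectionPreimage (c.N j.castSucc) (c.N j.succ) L = S := by
      rw [h1]
      have h3 : ∀ K : Set (c.N j.castSucc), (c.N j.succ).subtype ''
          (Subgroup.inclusion (c.lt_succ j).le '' K) = (c.N j.castSucc).subtype '' K := by
        intro K
        rw [← Set.image_comp]
        rfl
      constructor
      · rintro ⟨K, ⟨K, hK, rfl⟩ | ⟨L, hL, rfl⟩, rfl⟩
        · exact Or.inl ⟨K, hK, (h3 K).symm⟩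
        · exact Or.inr ⟨L, hL.1, hL.2, rfl⟩
      · rintro (⟨K, hK, rfl⟩ | ⟨L, hL, hL1, rfl⟩)
        · exact ⟨_, Or.inl ⟨K, hK, rfl⟩, h3 K⟩
        · exact ⟨_, Or.inr ⟨L, ⟨hL, hL1⟩, rfl⟩, rfl⟩
    rw [h2, ih, or_assoc]
    refine or_congr_right ⟨?_, ?_⟩
    · rintro (⟨i, hi, h⟩ | h)
      · exact ⟨i, hi.trans (Fin.castSucc_lt_succ), h⟩
      · exact ⟨j, Fin.castSucc_lt_succ, h⟩
    · rintro ⟨i, hi, h⟩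
      rcases eq_or_ne i j with rfl | hne
      · exact Or.inr h
      · refine Or.inl ⟨i, ?_, h⟩
        rw [Fin.castSucc_lt_castSucc_iff]
        rw [Fin.castSucc_lt_succ_iff] at hi
        exact lt_of_le_of_ne hi hne

/-- The superclasses of a product over a normal chain are `{1}` and the preimages of the nontrivial
superclasses of the factors. -/
theorem mem_product_classes (c : NormalChain G)
    (D : ∀ i : Fin c.length, SupercharacterTheory (c.Factor i)) (S : Set G) :
    S ∈ (c.product D).classes ↔ S = {1} ∨ ∃ i : Fin c.length, ∃ L ∈ (D i).classes, L ≠ {1} ∧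
      sectionPreimage (c.N i.castSucc) (c.N i.succ) L = S := by
  have h1 := c.mem_partialProduct_classes D (Fin.last c.length) S
  simp only [Fin.castSucc_lt_last, true_and] at h1
  rw [← h1]
  rfl

/-- A product over a normal chain factors over all terms of the chain. -/
theorem factorsClasses (c : NormalChain G)
    (D : ∀ i : Fin c.length, SupercharacterTheory (c.Factor i)) (j : Fin (c.length + 1)) :
    FactorsClasses (c.product D).classes (c.N j) := by
  intro S hS
  rw [mem_product_classes] at hS
  rcases hS with rfl | ⟨i, L, hL, hL1, rfl⟩
  · left
    rw [Set.singleton_subset_iff]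
    exact (c.N j).one_mem
  · rcases lt_or_ge i.castSucc j with h | h
    · left
      rw [Fin.castSucc_lt_iff_succ_le] at h
      exact (sectionPreimage_subset L).trans (c.strictMono.monotone h)
    · exact Or.inr fun x hx n hn =>
        mul_mem_sectionPreimage (c.lt_succ i).le hx (c.strictMono.monotone h hn)

variable [Finite G]

/-- If a supercharacter theory is the product of indecomposable factors over a normal chain, then
the terms of the chain are exactly the normal subgroups over which it factors. -/
theorem range_eq {C : SupercharacterTheory G} (c : NormalChain G)
    (D : ∀ i : Fin c.length, SupercharacterTheory (c.Factor i))
    (hD : ∀ i, ¬ (D i).Decomposable) (h : C.toPartPair = c.product D) :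
    Set.range c.N = {N | N.Normal ∧ FactorsClasses C.classes N} := by
  have hcl : C.classes = (c.product D).classes := by rw [h]
  have hfac : ∀ j, FactorsClasses C.classes (c.N j) := fun j => hcl ▸ c.factorsClasses D j
  apply Set.Subset.antisymm
  · rintro _ ⟨j, rfl⟩
    exact ⟨c.normal j, hfac j⟩
  rintro N ⟨hN, hNC⟩
  by_contra hcon
  have hne : ∀ j, c.N j ≠ N := fun j e => hcon ⟨j, e⟩
  have hlt : ∀ j, c.N j < N := by
    intro j
    induction j using Fin.induction with
    | zero => exact lt_of_le_of_ne (c.zero_eq ▸ bot_le) (hne 0)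
    | succ i ih =>
      refine lt_of_le_of_ne ?_ (hne _)
      refine (C.le_or_le_of_factorsClasses (hfac i.succ) hNC).resolve_right fun hle => hD i ?_
      refine SupercharacterTheory.decomposable_of_lt_of_lt (D i) (fun L hL hL1 => ?_) hNC ih
        (lt_of_le_of_ne hle (hne _).symm)
      rw [hcl, mem_product_classes]
      exact Or.inr ⟨i, L, hL, hL1, rfl⟩
  exact not_top_lt (c.last_eq ▸ hlt (Fin.last _))

/-- The factors of a product over a given normal chain are determined by the product. -/
theorem factors_eq {C : SupercharacterTheory G} (c : NormalChain G)
    {D D' : ∀ i : Fin c.length, SupercharacterTheory (c.Factor i)}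
    (h : C.toPartPair = c.product D) (h' : C.toPartPair = c.product D') : D = D' := by
  funext i
  refine SupercharacterTheory.eq_of_classes_eq
    ((D i).classes_isPartition.eq_of_subset (D' i).classes_isPartition fun L hL => ?_)
  by_cases hL1 : L = {1}
  · rw [hL1]
    exact (D' i).one_mem
  obtain ⟨x, hx⟩ := (D i).classes_isPartition.nonempty hL
  obtain ⟨L', hL', hx'⟩ := (D' i).classes_isPartition.exists_mem x
  have hL1' : L' ≠ {1} := by
    rintro rfl
    rw [Set.mem_singleton_iff.1 hx', (D i).one_mem_iff hL] at hx
    exact hL1 hx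
  have h1 : sectionPreimage _ _ L ∈ C.classes := by
    rw [h, mem_product_classes]
    exact Or.inr ⟨i, L, hL, hL1, rfl⟩
  have h2 : sectionPreimage _ _ L' ∈ C.classes := by
    rw [h', mem_product_classes]
    exact Or.inr ⟨i, L', hL', hL1', rfl⟩
  obtain ⟨y, rfl⟩ := QuotientGroup.mk'_surjective _ x
  have h3 := C.classes_isPartition.eq_of_mem h1 h2 (coe_mem_sectionPreimage.2 hx)
    (coe_mem_sectionPreimage.2 hx')
  rwa [sectionPreimage_injective h3]

end NormalChain

namespace SupercharacterTheory

variable {G : Type*} [Group G] [Finite G]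

/-- The normal subgroups over which a supercharacter theory factors form a normal chain. -/
theorem exists_normalChain (C : SupercharacterTheory G) :
    ∃ c : NormalChain G, Set.range c.N = {N | N.Normal ∧ FactorsClasses C.classes N} := by
  classical
  let P := {N : Subgroup G // N.Normal ∧ FactorsClasses C.classes N}
  let _ : LinearOrder P :=
    { (inferInstance : PartialOrder P) with
      le_total := fun M N => C.le_or_le_of_factorsClasses M.2.2 N.2.2
      toDecidableLE := Classical.decRel _ }
  have := Fintype.ofFinite P
  let b : P := ⟨⊥, inferInstance, fun K hK => Or.inr fun x hx n hn => by
    rwa [Subgroup.mem_bot.1 hn, mul_one]⟩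
  let t : P := ⟨⊤, inferInstance, fun K hK => Or.inl fun x _ => Subgroup.mem_top x⟩
  obtain ⟨r, hr⟩ : ∃ r, Fintype.card P = r + 1 :=
    ⟨_, (Nat.succ_pred_eq_of_pos (Fintype.card_pos_iff.2 ⟨b⟩)).symm⟩
  let e : Fin (r + 1) ≃o P := Fintype.orderIsoFinOfCardEq P hr
  refine ⟨⟨r, fun i => (e i).1, fun i => (e i).2.1, ?_, ?_, fun i => ?_⟩, ?_⟩
  · have h : e 0 ≤ b := by
      rw [← e.apply_symm_apply b, e.le_iff_le]
      exact Fin.zero_le _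
    exact le_bot_iff.1 h
  · have h : t ≤ e (Fin.last r) := by
      rw [← e.apply_symm_apply t, e.le_iff_le]
      exact Fin.le_last _
    exact top_le_iff.1 h
  · exact e.lt_iff_lt.2 Fin.castSucc_lt_succ
  · ext N
    constructor
    · rintro ⟨i, rfl⟩
      exact (e i).2
    · intro hN
      exact ⟨e.symm ⟨N, hN⟩, congrArg Subtype.val (e.apply_symm_apply ⟨N, hN⟩)⟩

end SupercharacterTheory

end

theorem mainTheorem2 {G : Type*} [Group G] [Finite G] [Nontrivial G]
    (C : SupercharacterTheory G) :
    ∃! F : (Σ c : NormalChain G, ∀ i : Fin c.length, SupercharacterTheory (c.Factor i)),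
      (∀ i : Fin F.1.length,
        (F.2 i).IsInvariant (conjQuotient (F.1.N i.castSucc) (F.1.N i.succ)) ∧
        (F.2 i).Indecomposable) ∧
      C.toPartPair = F.1.product F.2 := by
  obtain ⟨c, hc⟩ := C.exists_normalChain
  have hfac : ∀ j, FactorsClasses C.classes (c.N j) := fun j => (hc.subset ⟨j, rfl⟩).2
  have hR : ∀ j, ∃ R : SupercharacterTheory (c.N j),
      R.classes = {K | (c.N j).subtype '' K ∈ C.classes} := fun j =>
    C.exists_restrict (c.N j).subtype_injective
      (by rw [(c.N j).range_subtype]; exact C.subset_or_disjoint (hfac j))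
  choose R hR using hR
  have hD := fun i : Fin c.length => C.exists_section (c.lt_succ i).le (hfac i.castSucc)
    (R i.succ) (hR i.succ) (R i.castSucc) (hR i.castSucc)
  choose D hD hstar using hD
  have hpp : ∀ k, (R k).toPartPair = c.partialProduct D k := by
    intro k
    induction k using Fin.induction with
    | zero =>
      have : Subsingleton (c.N 0) := by
        rw [c.zero_eq]
        infer_instance
      exact (R 0).toPartPair_eq_of_subsingleton
    | succ i ih =>
      rw [hstar i, ih]
      rfl
  have hprod : C.toPartPair = c.product D := by
    rw [NormalChain.product, ← hpp]
    exact C.toPartPair_eq_transport _ _ (hR _)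
  have hind : ∀ i, (D i).Indecomposable := by
    refine fun i => ⟨?_, fun hdec => ?_⟩
    · obtain ⟨x, hx, hx'⟩ := SetLike.exists_of_lt (c.lt_succ i)
      refine ⟨QuotientGroup.mk' _ ⟨x, hx⟩, 1, fun h => hx' ?_⟩
      exact Subgroup.mem_subgroupOf.1 ((QuotientGroup.eq_one_iff _).1 h)
    · obtain ⟨K, hK, hKC, h1, h2⟩ := C.exists_lt_lt_of_decomposable (c.lt_succ i).le
        (hfac _) (hfac _) (D i) (hD i) hdec
      obtain ⟨j, rfl⟩ := hc.superset ⟨hK, hKC⟩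
      have h3 := c.strictMono.lt_iff_lt.1 h1
      have h4 := c.strictMono.lt_iff_lt.1 h2
      exact absurd h4 (not_lt.2 (Fin.castSucc_lt_iff_succ_le.1 h3))
  refine ⟨⟨c, D⟩, ⟨fun i => ⟨C.isInvariant_section (D i) (hD i), hind i⟩, hprod⟩, ?_⟩
  rintro ⟨c', D'⟩ ⟨h', hprod'⟩
  obtain rfl : c' = c := NormalChain.ext_of_range
    ((c'.range_eq D' (fun i => (h' i).2.2) hprod').trans hc.symm)
  obtain rfl : D' = D := c'.factors_eq hprod' hprod
  rfl
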